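/- **Lemma 4 (Embedding Lemma).** Graphs are finite digraphs in which a node may carry a self-loop. Two distinct nodes $u,v$ are *connected* if at least one of the edges $(u,v),(v,u)$ is present. The degree of a node $u$ is the number of nodes connected to $u$ (so a double edge counts once and a self-loop is not counted), and $\deg(F)$ is the maximal degree of the nodes of $F$. A *di-embedding* of $F$ into $G$ is a one-to-one map $g:V(F)\to V(G)$ that is an isomorphism, loops included, on each two-node induced subgraph $F[\{u,v\}]$ with $u,v$ connected. $F$ and $G$ are *compatible* if they have the same number of looped nodes and the same number of un-looped nodes. Let $\omega:\mathbb N\to\mathbb R$ satisfy $\omega_n\to\infty$. For every $\varepsilon>0$ there is an $N$, depending only on $\omega$ and $\varepsilon$, such that the following holds. Let $F$ be a digraph on $n\ge N$ nodes, let $H$ be an induced subgraph of $F$ (possibly empty), and put $d=\deg(F)$. Suppose that $$|F-H|>2d^34^d+\omega_n,$$ and that, moreover, the number of looped nodes of $F-H$ and the number of un-looped nodes of $F-H$ are each either $0$ or greater than $2d^34^d+\omega_n$. Let $G$ be a random digraph on the node set $V(F)$, in which each ordered pair of nodes (loops included) is an edge independently with probability $1/2$, conditioned on the event that $G$ contains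 $H$ as an induced subgraph (that is, $G[V(H)]=H$) and is compatible with $F$. Then with probability at least $1-\varepsilon$ there is a di-embedding $g$ of $F$ into $G$ with $g(u)=u$ for all $u\in V(H)$. -/

import Mathlib

open MeasureTheory ProbabilityTheory Filter Topology

namespace DiEmbed

variable {V W : Type*}

/-- Two distinct nodes are connected when at least one of the edges `(u, v)`, `(v, u)` is present
(a single or a double edge). -/
def Connected (F : Digraph V) (u v : V) : Prop :=
  u ≠ v ∧ (F.Adj u v ∨ F.Adj v u)

/-- The degree of a node: the number of incident incoming, outgoing or double edges. A double edge
is one incident edge, and a self-loop is not counted. -/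
noncomputable def nodeDegree (F : Digraph V) (u : V) : ℕ :=
  {v | Connected F u v}.ncard

/-- The degree of a digraph: the maximal degree of its nodes. -/
noncomputable def degree [Fintype V] (F : Digraph V) : ℕ :=
  Finset.univ.sup (nodeDegree F)

/-- The set of looped nodes. -/
def looped (F : Digraph V) : Set V := {v | F.Adj v v}

/-- The set of un-looped nodes. -/
def unlooped (F : Digraph V) : Set V := {v | ¬ F.Adj v v}

/-- `F` has the same number of looped and the same number of un-looped nodes as `G`. -/
def Compatible (F : Digraph V) (G : Digraph W) : Prop :=
  (looped F).ncard = (looped G).ncard ∧ (unlooped F).ncard = (unlooped G).ncard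

/-- `F` and `G` induce the same subgraph on the node set `S`; that is, with `H` the subgraph of `F`
induced on `S`, the digraph `G` also contains `H` as an induced subgraph. Loops are included. -/
def SameInducedOn (S : Set V) (F G : Digraph V) : Prop :=
  ∀ u ∈ S, ∀ v ∈ S, (F.Adj u v ↔ G.Adj u v)

/-- A di-embedding of `F` into `G`: a one-to-one map of nodes which restricts to an isomorphism
(loops included) on each two-node induced subgraph of `F` whose nodes are connected. -/
structure IsDiEmbedding (F : Digraph V) (G : Digraph W) (g : V → W) : Prop where
  injective : Function.Injective g
  iso : ∀ u v, Connected F u v → ∀ x ∈ ({u, v} : Set V), ∀ y ∈ ({u, v} : Set V),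
    (F.Adj x y ↔ G.Adj (g x) (g y))

/-- The digraph (loops allowed) with a given table of edges. -/
def ofTable (a : V × V → Bool) : Digraph V where
  Adj u v := a (u, v) = true

/-- The law of the edge table of a random digraph on `V`: each of the ordered pairs, loops
included, is an edge independently with probability `1/2`. -/
noncomputable def edgeLaw (V : Type*) [Fintype V] : Measure (V × V → Bool) :=
  Measure.pi fun _ => (PMF.uniformOfFintype Bool).toMeasure

/-- The law of a random digraph `G` on the nodes of `F`, conditioned on containing the subgraph of
`F` induced on `S` as an induced subgraph and on being compatible with `F`. -/
noncomputable def condLaw [Fintype V] (F : Digraph V) (S : Set V) : Measure (V × V → Bool) :=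
  (edgeLaw V)[|{a | SameInducedOn S F (ofTable a) ∧ Compatible F (ofTable a)}]

end DiEmbed

/-! Relabelling by a permutation that fixes `S` reduces to the case where `G` has exactly the loops
of `F` (`card_admissible_fail_le`). Off `S`, the looped and the un-looped nodes are split separately
into classes in which no two nodes are connected or share a neighbour. These are colour classes of a
graph of maximal degree at most `D = d² + d`, so `D + 1` colours suffice for each kind.

Starting from the identity on `S`, the classes are embedded one after the other, each onto itself.
Given the images of the earlier classes, `v` is a possible image of `u` when at most `2d` table
entries take prescribed values, which has probability at least `p = 4^(-d)`. Nodes of one class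
share no neighbour, so distinct pairs `(u, v)` involve disjoint sets of entries, and none of these
entries was examined before (`isSpread_fits`). Embedding a class of `k` nodes thus amounts to
finding a perfect matching in a random bipartite graph with independent edges (`card_fail_step_le`).

By Hall's theorem and a moment bound, the matching fails with probability of order at most `k
e^(-0.96kp) + (kp)² e^(-kp/3)` (`IsSpread.card_no_matching_le`). When `k` is near `d 4^d`, `log k`
is about `2d log 2 ≈ 1.386 d`, so `k ≥ 1.48 d 4^d` is enough for large `d`. The hypothesis `2 d³
4^d` makes the average class about `2 d 4^d`, so classes balanced up to a factor slightly below `2 /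
1.48` suffice. `exists_balanced_coloring` supplies the factor `1.33` by exchange arguments in the
spirit of the Hajnal–Szemerédi theorem. Bounded `d` is absorbed by `ω`. -/

namespace DiEmbed

/-! ### Recolouring along routes and colourings of least energy -/

section Coloring

open Classical in
/-- The colour class of `i`. -/
noncomputable def colorClass {U ι : Type*} [Fintype U] (c : U → ι) (i : ι) : Finset U :=
  Finset.univ.filter fun v => c v = i

/-- A proper colouring of the nodes of `G`. -/
def IsProper {U ι : Type*} (G : SimpleGraph U) (c : U → ι) : Prop :=
  ∀ u v, G.Adj u v → c u ≠ c v

/-- `x` has no neighbour of colour `j`. -/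
def FreeFor {U ι : Type*} (G : SimpleGraph U) (c : U → ι) (x : U) (j : ι) : Prop :=
  ∀ y, c y = j → ¬ G.Adj x y

open Classical in
/-- `Route G c h P X`: colours in `P` form a simple path from `X` to a class of size at most `h`,
along which single nodes can be recoloured. -/
inductive Route {U ι : Type*} [Fintype U] (G : SimpleGraph U) (c : U → ι) (h : ℕ) :
    Finset ι → ι → Prop
  | sink (k : ι) : (colorClass c k).card ≤ h → Route G c h {k} k
  | step (P : Finset ι) (x : U) (Y : ι) : c x ∉ P → Route G c h P Y → FreeFor G c x Y →
      Route G c h (insert (c x) P) (c x)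

open Classical in
theorem IsProper.update {U ι : Type*} {G : SimpleGraph U} {c : U → ι} {x : U} {Y : ι}
    (hc : IsProper G c)
    (hf : ∀ w, w ≠ x → c w = Y → ¬ G.Adj x w) : IsProper G (Function.update c x Y) := by
  intro u v huv
  have hne := huv.ne
  by_cases hu : u = x
  · subst hu
    have hv : v ≠ u := hne.symm
    simp only [Function.update_self, Function.update_of_ne hv]
    exact fun he => hf v hv he.symm huv
  · by_cases hv : v = x
    · subst hv
      simp only [Function.update_self, Function.update_of_ne hu]
      exact fun he => hf u hu he huv.symm
    · simp only [Function.update_of_ne hu, Function.update_of_ne hv]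
      exact hc u v huv

variable {U ι : Type*} [Fintype U] {G : SimpleGraph U} {c : U → ι} {h : ℕ}

theorem mem_colorClass {v : U} {i : ι} : v ∈ colorClass c i ↔ c v = i := by
  simp [colorClass]

theorem Route.mem {P : Finset ι} {X : ι} (hr : Route G c h P X) : X ∈ P := by
  cases hr <;> simp

/-- A route visits each colour once, so the part from a later colour onward misses the start. -/
theorem Route.tail {P : Finset ι} {X Y : ι} (hr : Route G c h P X) (hY : Y ∈ P) :
    ∃ P' ⊆ P, Route G c h P' Y ∧ (Y ≠ X → X ∉ P') := by
  classical
  induction hr with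
  | sink k hk =>
    obtain rfl : Y = k := by simpa using hY
    exact ⟨_, subset_rfl, Route.sink _ hk, fun hne => absurd rfl hne⟩
  | step P x Z hx hr hf ih =>
    rcases Finset.mem_insert.1 hY with rfl | hY
    · exact ⟨_, subset_rfl, Route.step P x Z hx hr hf, fun hne => absurd rfl hne⟩
    · obtain ⟨P', hP', hr', -⟩ := ih hY
      exact ⟨P', hP'.trans (Finset.subset_insert _ _), hr', fun _ hmem => hx (hP' hmem)⟩

theorem Route.prepend {P : Finset ι} {Y : ι} (hr : Route G c h P Y) {x : U}
    (hf : FreeFor G c x Y) : ∃ P', Route G c h P' (c x) ∧ ∀ Z ∈ P', Z = c x ∨ Z ∈ P := by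
  classical
  by_cases hx : c x ∈ P
  · obtain ⟨P', hP', hr', -⟩ := hr.tail hx
    exact ⟨P', hr', fun Z hZ => Or.inr (hP' hZ)⟩
  · exact ⟨_, Route.step P x Y hx hr hf, fun Z hZ => Finset.mem_insert.1 hZ⟩

-- The indicators stand on both sides to avoid subtraction, and the identity also covers `c x = Y`.
open Classical in
theorem card_colorClass_update (x : U) (Y i : ι) :
    (colorClass (Function.update c x Y) i).card + (if i = c x then 1 else 0) =
      (colorClass c i).card + (if i = Y then 1 else 0) := by
  have key : ∀ (f : U → ι), (colorClass f i).card =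
      ∑ v ∈ Finset.univ.erase x, (if f v = i then 1 else 0) + (if f x = i then 1 else 0) := by
    intro f
    rw [colorClass, Finset.card_filter, ← Finset.sum_erase_add _ _ (Finset.mem_univ x)]
  rw [key, key c]
  have : ∑ v ∈ Finset.univ.erase x, (if Function.update c x Y v = i then 1 else 0) =
      ∑ v ∈ Finset.univ.erase x, (if c v = i then 1 else 0) := by
    refine Finset.sum_congr rfl fun v hv => ?_
    rw [Function.update_of_ne (Finset.ne_of_mem_erase hv)]
  rw [this, Function.update_self]
  simp only [eq_comm (a := i)]
  omega

open Classical in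
/-- Recolouring along a route moves one unit of size from its start to a small class. -/
theorem Route.shift {P : Finset ι} {X : ι} (hr : Route G c h P X) (hc : IsProper G c) :
    ∃ (c' : U → ι) (k : ι), IsProper G c' ∧ (∀ v, c v ∉ P → c' v = c v) ∧
      (∀ v, c v ∈ P → c' v ∈ P) ∧ (∀ v, c' v = X → c v = X) ∧ (colorClass c k).card ≤ h ∧
      ∀ i, (colorClass c' i).card + (if i = X then 1 else 0) =
        (colorClass c i).card + (if i = k then 1 else 0) := by
  induction hr with
  | sink k hk => exact ⟨c, k, hc, fun _ _ => rfl, fun _ => id, fun _ => id, hk, fun _ => rfl⟩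
  | step P x Y hx hr hf ih =>
    obtain ⟨c', k, hp, hout, hin, hst, hk, hsz⟩ := ih
    have hxc : c' x = c x := hout x hx
    have hYP := hr.mem
    -- The rest of the route is recoloured first. By `hst` the class `Y` gains no node in doing so,
    -- so `x` can still enter it.
    refine ⟨Function.update c' x Y, k, hp.update fun w _ hw => hf w (hst w hw), ?_, ?_, ?_, hk, ?_⟩
    · intro v hv
      simp only [Finset.mem_insert, not_or] at hv
      rw [Function.update_of_ne (fun he => hv.1 (congrArg c he)), hout v hv.2]
    · intro v hv
      by_cases hvx : v = x
      · subst hvx; simp [hYP]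
      · rw [Function.update_of_ne hvx]
        rcases Finset.mem_insert.1 hv with he | he
        · rw [hout v (he ▸ hx), he]; simp
        · exact Finset.mem_insert_of_mem (hin v he)
    · intro v hv
      by_cases hvx : v = x
      · rw [hvx]
      · rw [Function.update_of_ne hvx] at hv
        by_cases hvP : c v ∈ P
        · exact absurd (hv ▸ hin v hvP) hx
        · rw [← hout v hvP, hv]
    · intro i
      have h1 := card_colorClass_update (c := c') x Y i
      have h2 := hsz i
      rw [hxc] at h1
      omega

/-- The potential minimised by a balanced colouring. -/
noncomputable def sizeEnergy [Fintype ι] (c : U → ι) : ℕ := ∑ i, (colorClass c i).card ^ 2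

-- Moving one unit from a class of size `b` to one of size `a` changes the sum of squares by `2(a -
-- b) + 2`, which is negative if `a + 2 ≤ b`.
open Classical in
theorem sizeEnergy_lt [Fintype ι] {c' : U → ι} {X k : ι}
    (hsz : ∀ i, (colorClass c' i).card + (if i = X then 1 else 0) =
        (colorClass c i).card + (if i = k then 1 else 0))
    (hlt : (colorClass c k).card + 2 ≤ (colorClass c X).card) : sizeEnergy c' < sizeEnergy c := by
  have hle : ∀ i, ((colorClass c' i).card : ℤ) ^ 2 ≤ ((colorClass c i).card : ℤ) ^ 2 +
      ((if i = k then 2 * ((colorClass c k).card : ℤ) + 1 else 0) +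
      (if i = X then 1 - 2 * ((colorClass c X).card : ℤ) else 0)) := by
    intro i
    have := hsz i
    by_cases h1 : i = X <;> by_cases h2 : i = k
    · subst h1; subst h2; omega
    · subst h1
      have : ((colorClass c' i).card : ℤ) = (colorClass c i).card - 1 := by
        simp [h2] at this; omega
      rw [this]; simp [h2]; apply le_of_eq; ring
    · subst h2
      have : ((colorClass c' i).card : ℤ) = (colorClass c i).card + 1 := by
        simp [h1] at this; omega
      rw [this]; simp [h1]; apply le_of_eq; ring
    · have : ((colorClass c' i).card : ℤ) = (colorClass c i).card := by
        simp [h1, h2] at this; omega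
      rw [this]; simp [h1, h2]
  have hsum := Finset.sum_le_sum fun i (_ : i ∈ Finset.univ) => hle i
  rw [Finset.sum_add_distrib, Finset.sum_add_distrib, Finset.sum_ite_eq' Finset.univ k,
    Finset.sum_ite_eq' Finset.univ X] at hsum
  simp only [Finset.mem_univ, if_true] at hsum
  have : ((sizeEnergy c' : ℕ) : ℤ) < (sizeEnergy c : ℕ) := by
    simp only [sizeEnergy]; push_cast; omega
  exact_mod_cast this

/-- A proper colouring of least energy. -/
def IsLeast [Fintype ι] (G : SimpleGraph U) (c : U → ι) : Prop :=
  IsProper G c ∧ ∀ c' : U → ι, IsProper G c' → sizeEnergy c ≤ sizeEnergy c'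

theorem IsLeast.card_le_of_route [Fintype ι] (hc : IsLeast G c) {P : Finset ι} {X : ι}
    (hr : Route G c h P X) : (colorClass c X).card ≤ h + 1 := by
  obtain ⟨c', k, hp, -, -, -, hk, hsz⟩ := hr.shift hc.1
  by_contra hlt
  exact absurd (hc.2 c' hp) (not_le.2 (sizeEnergy_lt hsz (by omega)))

/-- In a colouring of least energy, a node `z` that is the only neighbour of `y` in its class
cannot move to a class with a route avoiding the class of `z`. -/
theorem IsLeast.not_freeFor_of_solo [Fintype ι] (hc : IsLeast G c) {P : Finset ι} {X : ι}
    (hr : Route G c h P X) {y z : U} (hz : c z ∉ P) (hy : c y ∉ P) (hyz : c y ≠ c z)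
    (hcard : h + 2 ≤ (colorClass c (c y)).card)
    (hsolo : ∀ w, c w = c z → G.Adj y w → w = z) : ¬ FreeFor G c z X := by
  classical
  intro hf
  obtain ⟨c', k, hp, hout, hin, hst, hk, hsz⟩ := hr.shift hc.1
  have hXz : X ≠ c z := fun he => hz (he ▸ hr.mem)
  have hne : y ≠ z := fun he => hyz (he ▸ rfl)
  -- After the shift along the route, `z` enters `X` and `y` takes the place of `z`, its only
  -- obstacle there. In total the class of `y` loses a node and the small class `k` gains one, so
  -- the energy drops.
  have hp1 : IsProper G (Function.update c' z X) := hp.update fun w _ hw => hf w (hst w hw)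
  have hp2 : IsProper G (Function.update (Function.update c' z X) y (c z)) := by
    refine hp1.update fun w _ hw hadj => ?_
    by_cases hwz : w = z
    · rw [hwz, Function.update_self] at hw; exact hXz hw
    · rw [Function.update_of_ne hwz] at hw
      have hwP : c w ∉ P := fun hmem => hz (hw ▸ hin w hmem)
      exact hwz (hsolo w (by rw [← hout w hwP, hw]) hadj)
  refine absurd (hc.2 _ hp2) (not_le.2 (sizeEnergy_lt (X := c y) (k := k) (fun i => ?_) (by omega)))
  have h1 := hsz i
  have h2 := card_colorClass_update (c := c') z X i
  have h3 := card_colorClass_update (c := Function.update c' z X) y (c z) i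
  rw [Function.update_of_ne hne, hout y hy] at h3
  rw [hout z hz] at h2
  omega

end Coloring

/-! ### Accessible classes and terminal families -/

section Coloring

variable {U ι : Type*} [Fintype U] [Fintype ι] {G : SimpleGraph U} {c : U → ι} {h : ℕ}

open Classical in
/-- The colours from which a class of size at most `h` can be reached. -/
noncomputable def accessible (G : SimpleGraph U) (c : U → ι) (h : ℕ) : Finset ι :=
  Finset.univ.filter fun X => ∃ P, Route G c h P X

theorem mem_accessible {X : ι} : X ∈ accessible G c h ↔ ∃ P, Route G c h P X := by
  simp [accessible]

theorem Route.subset_accessible {P : Finset ι} {X : ι} (hr : Route G c h P X) :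
    P ⊆ accessible G c h := fun _ hY =>
  let ⟨P', _, hr', _⟩ := hr.tail hY
  mem_accessible.2 ⟨P', hr'⟩

theorem not_freeFor_of_notMem_accessible {y : U} {W : ι} (hy : c y ∉ accessible G c h)
    (hW : W ∈ accessible G c h) : ¬ FreeFor G c y W := by
  intro hf
  obtain ⟨P, hr⟩ := mem_accessible.1 hW
  obtain ⟨P₁, hr₁, -⟩ := hr.prepend hf
  exact hy (mem_accessible.2 ⟨P₁, hr₁⟩)

/-- There is a nonempty family of terminal accessible classes whose nodes can move to at most one
accessible class outside the family. -/
theorem exists_terminal_family (hne : (accessible G c h).Nonempty) :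
    ∃ T ⊆ accessible G c h, T.Nonempty ∧ ∃ E : Finset ι, E.card ≤ 1 ∧
      (∀ W ∈ T, ∀ X ∈ accessible G c h, X ≠ W → ∃ P, Route G c h P X ∧ W ∉ P) ∧
      (∀ x, c x ∈ T → ∀ X ∈ accessible G c h, X ∉ T → X ∉ E → ¬ FreeFor G c x X) := by
  classical
  -- `dep Z` collects the classes that lose every route when `Z` is removed.
  let dep : ι → Finset ι := fun Z => (accessible G c h).filter fun X =>
    X ≠ Z ∧ ∀ P, Route G c h P X → Z ∈ P
  have hdep : ∀ {X Z}, X ∈ dep Z ↔ X ∈ accessible G c h ∧ X ≠ Z ∧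
      ∀ P, Route G c h P X → Z ∈ P := by
    intro X Z; simp [dep]
  by_cases hall : ∀ W ∈ accessible G c h, dep W = ∅
  · refine ⟨_, subset_rfl, hne, ∅, by simp, ?_, fun x _ X hX hX' => absurd hX hX'⟩
    intro W hW X hX hXW
    by_contra hcon
    push Not at hcon
    have : X ∈ dep W := hdep.2 ⟨hX, hXW, hcon⟩
    rw [hall W hW] at this
    simp at this
  · push Not at hall
    obtain ⟨W₀, hW₀, hd₀⟩ := hall
    -- For a smallest nonempty `dep Z` and `W` in it, `dep W` is strictly smaller (it omits `W`),
    -- hence empty: every such `W` is terminal. The one exceptional target is `Z` itself.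
    obtain ⟨Z, hZ, hmin⟩ := Finset.exists_min_image
      ((accessible G c h).filter fun W => (dep W).Nonempty) (fun W => (dep W).card)
      ⟨W₀, Finset.mem_filter.2 ⟨hW₀, hd₀⟩⟩
    obtain ⟨hZA, hZne⟩ := Finset.mem_filter.1 hZ
    refine ⟨dep Z, Finset.filter_subset _ _, hZne, {Z}, by simp, ?_, ?_⟩
    · intro W hW X hX hXW
      by_contra hcon
      push Not at hcon
      have hXd : X ∈ dep W := hdep.2 ⟨hX, hXW, hcon⟩
      obtain ⟨hWA, hWZ, hWr⟩ := hdep.1 hW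
      have hsub : dep W ⊆ dep Z := by
        intro Y hY
        obtain ⟨hYA, hYW, hYr⟩ := hdep.1 hY
        refine hdep.2 ⟨hYA, ?_, ?_⟩
        · rintro rfl
          obtain ⟨P, hr⟩ := mem_accessible.1 hWA
          obtain ⟨P', -, hr', hP'⟩ := hr.tail (hWr P hr)
          exact hP' (Ne.symm hWZ) (hYr P' hr')
        · intro P hr
          obtain ⟨P', hPP, hr', -⟩ := hr.tail (hYr P hr)
          exact hPP (hWr P' hr')
      have hlt : (dep W).card < (dep Z).card := by
        refine Finset.card_lt_card ⟨hsub, fun hsub' => ?_⟩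
        exact (hdep.1 (hsub' hW)).2.1 rfl
      exact absurd (hmin W (Finset.mem_filter.2 ⟨hWA, ⟨X, hXd⟩⟩)) (not_le.2 hlt)
    · intro x hx X hX hXd hXZ hf
      obtain ⟨hxA, hxZ, hxr⟩ := hdep.1 hx
      have hXZ' : X ≠ Z := by simpa using hXZ
      have : ¬ ∀ P, Route G c h P X → Z ∈ P := fun hcon => hXd (hdep.2 ⟨hX, hXZ', hcon⟩)
      push Not at this
      obtain ⟨P, hr, hZP⟩ := this
      obtain ⟨P', hr', hP'⟩ := hr.prepend hf
      rcases hP' Z (hxr P' hr') with he | he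
      · exact hxZ he.symm
      · exact hZP he

end Coloring

/-! ### Counting neighbours by colour -/

section ColorDegree

variable {U ι : Type*} [Fintype U] {G : SimpleGraph U} {c : U → ι}

open Classical in
/-- The number of neighbours of `x` of colour `i`. -/
noncomputable def colorDegree (G : SimpleGraph U) (c : U → ι) (x : U) (i : ι) : ℕ :=
  (Finset.univ.filter fun w => G.Adj x w ∧ c w = i).card

theorem colorDegree_pos {x : U} {i : ι} : 1 ≤ colorDegree G c x i ↔ ¬ FreeFor G c x i := by
  rw [colorDegree, Nat.one_le_iff_ne_zero, ← Nat.pos_iff_ne_zero, Finset.card_pos]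
  simp only [FreeFor, Finset.Nonempty, Finset.mem_filter, Finset.mem_univ, true_and]
  push Not
  exact ⟨fun ⟨w, h1, h2⟩ => ⟨w, h2, h1⟩, fun ⟨w, h1, h2⟩ => ⟨w, h2, h1⟩⟩

open Classical in
theorem sum_colorDegree_add_card_le {D : ℕ}
    (hD : ∀ x, (Finset.univ.filter fun w => G.Adj x w).card ≤ D) (x : U) (T : Finset ι)
    (B : Finset U) (hB : ∀ y ∈ B, c y ∉ T) :
    ∑ i ∈ T, colorDegree G c x i + (B.filter fun y => G.Adj x y).card ≤ D := by
  refine le_trans ?_ (hD x)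
  have h1 : ∑ i ∈ T, colorDegree G c x i =
      (Finset.univ.filter fun w => G.Adj x w ∧ c w ∈ T).card := by
    rw [Finset.card_eq_sum_card_fiberwise (f := c) (t := T)
      (fun w hw => (Finset.mem_filter.1 hw).2.2)]
    refine Finset.sum_congr rfl fun i hi => ?_
    rw [colorDegree, Finset.filter_filter]
    congr 1
    ext w
    simp only [Finset.mem_filter, Finset.mem_univ, true_and]
    constructor
    · rintro ⟨h1, rfl⟩; exact ⟨⟨h1, hi⟩, rfl⟩
    · rintro ⟨⟨h1, -⟩, h2⟩; exact ⟨h1, h2⟩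
  rw [h1, ← Finset.card_union_of_disjoint]
  · refine Finset.card_le_card fun w hw => ?_
    simp only [Finset.mem_union, Finset.mem_filter, Finset.mem_univ, true_and] at hw ⊢
    tauto
  · rw [Finset.disjoint_left]
    intro w hw hw'
    simp only [Finset.mem_filter, Finset.mem_univ, true_and] at hw hw'
    exact hB w hw'.1 hw.2

open Classical in
theorem sum_colorDegree_eq (B : Finset U) (W : ι) :
    ∑ y ∈ B, colorDegree G c y W =
      ∑ z ∈ colorClass c W, (B.filter fun y => G.Adj z y).card := by
  simp only [colorDegree, colorClass, Finset.card_filter]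
  rw [Finset.sum_comm, Finset.sum_filter]
  refine Finset.sum_congr rfl fun z _ => ?_
  by_cases hz : c z = W
  · simp [hz, G.adj_comm]
  · simp [hz]

end ColorDegree

/-! ### Nearly balanced proper colourings -/

section Balanced

variable {U ι : Type*} [Fintype U] [Fintype ι] {G : SimpleGraph U} {c : U → ι} {h D x : ℕ}
  {B : Finset U}

-- Each class of `T` uses up at least one of the at most `D` edges at `z`.
open Classical in
theorem card_filter_adj_le_of_not_freeFor
    (hD : ∀ x, (Finset.univ.filter fun w => G.Adj x w).card ≤ D)
    (hB : ∀ y ∈ B, c y ∉ accessible G c h) {T : Finset ι} (hT : T ⊆ accessible G c h) {z : U}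
    (hz : ∀ X ∈ T, ¬ FreeFor G c z X) : (B.filter fun y => G.Adj z y).card + T.card ≤ D := by
  have h1 := sum_colorDegree_add_card_le hD z T B fun y hy hyT => hB y hy (hT hyT)
  have h2 : T.card ≤ ∑ i ∈ T, colorDegree G c z i := by
    rw [Finset.card_eq_sum_ones]
    exact Finset.sum_le_sum fun X hX => colorDegree_pos.2 (hz X hX)
  omega

theorem one_le_colorDegree (hB : ∀ y ∈ B, c y ∉ accessible G c h) {y : U} (hy : y ∈ B) {W : ι}
    (hW : W ∈ accessible G c h) : 1 ≤ colorDegree G c y W :=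
  colorDegree_pos.2 (not_freeFor_of_notMem_accessible (hB y hy) hW)

open Classical in
/-- Few nodes lie in large inaccessible classes when the terminal family is small. -/
theorem card_le_of_isolated_family (hc : IsLeast G c)
    (hD : ∀ x, (Finset.univ.filter fun w => G.Adj x w).card ≤ D)
    (hB : ∀ y ∈ B, c y ∉ accessible G c h) (hx : (accessible G c h).card + x = D)
    {T E : Finset ι} (hT : T ⊆ accessible G c h) (hne : T.Nonempty) (hE : E.card ≤ 1)
    (hiso : ∀ z, c z ∈ T → ∀ X ∈ accessible G c h, X ∉ T → X ∉ E → ¬ FreeFor G c z X) :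
    B.card ≤ (h + 1) * (x + T.card + 1) := by
  have hpos := hne.card_pos
  have hlow : T.card * B.card ≤ ∑ W ∈ T, ∑ y ∈ B, colorDegree G c y W := by
    rw [← smul_eq_mul]
    refine Finset.card_nsmul_le_sum _ _ _ fun W hW => ?_
    rw [Finset.card_eq_sum_ones]
    exact Finset.sum_le_sum fun y hy => one_le_colorDegree hB hy (hT hW)
  have hup : ∑ W ∈ T, ∑ y ∈ B, colorDegree G c y W ≤
      T.card * ((h + 1) * (x + T.card + 1)) := by
    rw [← smul_eq_mul]
    refine Finset.sum_le_card_nsmul _ _ _ fun W hW => ?_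
    rw [sum_colorDegree_eq]
    obtain ⟨P, hr⟩ := mem_accessible.1 (hT hW)
    refine le_trans (Finset.sum_le_card_nsmul _ _ (x + T.card + 1) fun z hz => ?_)
      (Nat.mul_le_mul_right _ (hc.card_le_of_route hr))
    have hzW := mem_colorClass.1 hz
    -- With `q` accessible and `t` terminal classes, `z` has neighbours in at least `q - t - 1`
    -- accessible classes outside `T` and `E`. At most `D - (q - t - 1) = x + t + 1` edges remain
    -- for `B`.
    have h1 := card_filter_adj_le_of_not_freeFor (T := (accessible G c h \ T) \ E) (z := z) hD hB
      (Finset.sdiff_subset.trans Finset.sdiff_subset) (by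
        intro X hX
        simp only [Finset.mem_sdiff] at hX
        exact hiso z (hzW ▸ hW) X hX.1.1 hX.1.2 hX.2)
    have h2 := Finset.le_card_sdiff E (accessible G c h \ T)
    have h3 := Finset.card_sdiff_of_subset hT
    have h4 := Finset.card_le_card hT
    omega
  exact Nat.le_of_mul_le_mul_left (hlow.trans hup) hpos

open Classical in
/-- A node of a terminal class that is the only neighbour there of a node in a large inaccessible
class has few neighbours in such classes. -/
theorem card_filter_adj_le_of_solo (hc : IsLeast G c)
    (hD : ∀ x, (Finset.univ.filter fun w => G.Adj x w).card ≤ D)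
    (hB : ∀ y ∈ B, c y ∉ accessible G c h) (hB' : ∀ y ∈ B, h + 2 ≤ (colorClass c (c y)).card)
    (hx : (accessible G c h).card + x = D) {y z : U} (hzA : c z ∈ accessible G c h)
    (hterm : ∀ X ∈ accessible G c h, X ≠ c z → ∃ P, Route G c h P X ∧ c z ∉ P)
    (hy : y ∈ B) (hyz : G.Adj z y) (hsolo : colorDegree G c y (c z) = 1) :
    (B.filter fun y => G.Adj z y).card ≤ x + 1 := by
  -- The exchange argument forces a neighbour of `z` in each of the other `q - 1` accessible
  -- classes, leaving `D - (q - 1) = x + 1` edges.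
  have h1 := card_filter_adj_le_of_not_freeFor (T := (accessible G c h).erase (c z)) (z := z) hD hB
    (Finset.erase_subset _ _) (by
      intro X hX
      obtain ⟨hXz, hXA⟩ := Finset.mem_erase.1 hX
      obtain ⟨P, hr, hzP⟩ := hterm X hXA hXz
      refine hc.not_freeFor_of_solo hr hzP (fun hmem => hB y hy (hr.subset_accessible hmem))
        (fun he => hB y hy (he ▸ hzA)) (hB' y hy) ?_
      intro w hw hadj
      obtain ⟨w', hw'⟩ := Finset.card_eq_one.1 hsolo
      have hmem : ∀ u, G.Adj y u ∧ c u = c z → u = w' := fun u hu => by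
        have : u ∈ ({w'} : Finset U) := hw' ▸ Finset.mem_filter.2 ⟨Finset.mem_univ u, hu⟩
        simpa using this
      rw [hmem w ⟨hadj, hw⟩, hmem z ⟨hyz.symm, rfl⟩])
  have h2 := Finset.card_erase_of_mem hzA
  have h3 := Finset.card_pos.2 ⟨_, hzA⟩
  omega

open Classical in
theorem card_solo_eq {U ι : Type*} [Fintype U] {G : SimpleGraph U} {c : U → ι} {B : Finset U}
    (W : ι) :
    (B.filter fun y => colorDegree G c y W = 1).card = ∑ z ∈ colorClass c W,
      ((B.filter fun y => colorDegree G c y W = 1).filter fun y => G.Adj z y).card := by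
  rw [← sum_colorDegree_eq, Finset.card_eq_sum_ones]
  exact Finset.sum_congr rfl fun y hy => (Finset.mem_filter.1 hy).2.symm

open Classical in
theorem card_solo_le (hc : IsLeast G c)
    (hD : ∀ x, (Finset.univ.filter fun w => G.Adj x w).card ≤ D)
    (hB : ∀ y ∈ B, c y ∉ accessible G c h) (hB' : ∀ y ∈ B, h + 2 ≤ (colorClass c (c y)).card)
    (hx : (accessible G c h).card + x = D) {W : ι} (hW : W ∈ accessible G c h)
    (hterm : ∀ X ∈ accessible G c h, X ≠ W → ∃ P, Route G c h P X ∧ W ∉ P) :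
    (B.filter fun y => colorDegree G c y W = 1).card ≤ (h + 1) * (x + 1) := by
  rw [card_solo_eq]
  obtain ⟨P, hr⟩ := mem_accessible.1 hW
  refine le_trans (Finset.sum_le_card_nsmul _ _ (x + 1) fun z hz => ?_)
    (Nat.mul_le_mul_right _ (hc.card_le_of_route hr))
  obtain rfl := mem_colorClass.1 hz
  rcases Finset.eq_empty_or_nonempty
    ((B.filter fun y => colorDegree G c y (c z) = 1).filter fun y => G.Adj z y) with he | ⟨y, hy⟩
  · simp [he]
  · simp only [Finset.mem_filter] at hy
    refine le_trans (Finset.card_le_card ?_)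
      (card_filter_adj_le_of_solo hc hD hB hB' hx hW hterm hy.1.1 hy.2 hy.1.2)
    exact Finset.filter_subset_filter _ (Finset.filter_subset _ _)

-- Edges between `B` and the class `W` are counted, twice when the end in `B` has no other neighbour
-- in `W`. Each node of `B` then weighs at least `2`. A node of `W` weighs at most `D` if none of
-- its edges counts twice, and otherwise has at most `x + 1` neighbours in `B`.
open Classical in
theorem two_mul_card_le (hc : IsLeast G c)
    (hD : ∀ x, (Finset.univ.filter fun w => G.Adj x w).card ≤ D)
    (hB : ∀ y ∈ B, c y ∉ accessible G c h) (hB' : ∀ y ∈ B, h + 2 ≤ (colorClass c (c y)).card)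
    (hx : (accessible G c h).card + x = D) {W : ι} (hW : W ∈ accessible G c h)
    (hterm : ∀ X ∈ accessible G c h, X ≠ W → ∃ P, Route G c h P X ∧ W ∉ P) :
    2 * B.card ≤ (h + 1) * max D (2 * (x + 1)) := by
  have hlow : 2 * B.card ≤ ∑ y ∈ B, colorDegree G c y W +
      (B.filter fun y => colorDegree G c y W = 1).card := by
    rw [Finset.card_filter, ← Finset.sum_add_distrib, mul_comm, ← smul_eq_mul]
    refine Finset.card_nsmul_le_sum _ _ _ fun y hy => ?_
    have := one_le_colorDegree hB hy hW
    split_ifs <;> omega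
  refine hlow.trans ?_
  rw [card_solo_eq, sum_colorDegree_eq, ← Finset.sum_add_distrib]
  obtain ⟨P, hr⟩ := mem_accessible.1 hW
  refine le_trans (Finset.sum_le_card_nsmul _ _ (max D (2 * (x + 1))) fun z hz => ?_)
    (Nat.mul_le_mul_right _ (hc.card_le_of_route hr))
  obtain rfl := mem_colorClass.1 hz
  have hsub : ((B.filter fun y => colorDegree G c y (c z) = 1).filter fun y => G.Adj z y).card ≤
      (B.filter fun y => G.Adj z y).card :=
    Finset.card_le_card (Finset.filter_subset_filter _ (Finset.filter_subset _ _))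
  rcases Finset.eq_empty_or_nonempty
    ((B.filter fun y => colorDegree G c y (c z) = 1).filter fun y => G.Adj z y) with he | ⟨y, hy⟩
  · rw [he, Finset.card_empty, add_zero]
    have := card_filter_adj_le_of_not_freeFor (T := ∅) (z := z) hD hB (by simp) (by simp)
    exact le_max_of_le_left (by simpa using this)
  · simp only [Finset.mem_filter] at hy
    have := card_filter_adj_le_of_solo hc hD hB hB' hx hW hterm hy.1.1 hy.2 hy.1.2
    exact le_max_of_le_right (by omega)

-- A node of `B` has a neighbour in all `q` accessible classes but at most `D = q + x` edges. So it
-- has exactly one neighbour in all but at most `x` classes of `T`, and `card_solo_le` bounds how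
-- often this happens.
open Classical in
theorem card_mul_card_le (hc : IsLeast G c)
    (hD : ∀ x, (Finset.univ.filter fun w => G.Adj x w).card ≤ D)
    (hB : ∀ y ∈ B, c y ∉ accessible G c h) (hB' : ∀ y ∈ B, h + 2 ≤ (colorClass c (c y)).card)
    (hx : (accessible G c h).card + x = D) {T : Finset ι} (hT : T ⊆ accessible G c h)
    (hterm : ∀ W ∈ T, ∀ X ∈ accessible G c h, X ≠ W → ∃ P, Route G c h P X ∧ W ∉ P) :
    B.card * T.card ≤ T.card * ((h + 1) * (x + 1)) + B.card * x := by
  have h1 : ∀ y ∈ B, T.card ≤ (T.filter fun W => colorDegree G c y W = 1).card + x := by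
    intro y hy
    have hdeg := sum_colorDegree_add_card_le (c := c) hD y (accessible G c h) ∅ (by simp)
    have hsub := Finset.sum_sdiff (f := fun i => colorDegree G c y i) hT
    have hrest : (accessible G c h \ T).card ≤
        ∑ i ∈ accessible G c h \ T, colorDegree G c y i := by
      rw [Finset.card_eq_sum_ones]
      exact Finset.sum_le_sum fun W hW => one_le_colorDegree hB hy (Finset.sdiff_subset hW)
    have hmain : 2 * T.card ≤ ∑ i ∈ T, colorDegree G c y i +
        (T.filter fun W => colorDegree G c y W = 1).card := by
      rw [Finset.card_filter, ← Finset.sum_add_distrib, mul_comm, ← smul_eq_mul]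
      refine Finset.card_nsmul_le_sum _ _ _ fun W hW => ?_
      have := one_le_colorDegree hB hy (hT hW)
      split_ifs <;> omega
    have h3 := Finset.card_sdiff_of_subset hT
    have h4 := Finset.card_le_card hT
    simp only [Finset.filter_empty, Finset.card_empty, add_zero] at hdeg
    omega
  have h2 : B.card * T.card ≤
      ∑ y ∈ B, ((T.filter fun W => colorDegree G c y W = 1).card + x) := by
    rw [← smul_eq_mul]
    exact Finset.card_nsmul_le_sum _ _ _ h1
  rw [Finset.sum_add_distrib, Finset.sum_const, smul_eq_mul] at h2
  refine h2.trans (Nat.add_le_add_right ?_ _)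
  have h3 : ∑ y ∈ B, (T.filter fun W => colorDegree G c y W = 1).card =
      ∑ W ∈ T, (B.filter fun y => colorDegree G c y W = 1).card := by
    simp only [Finset.card_filter]
    exact Finset.sum_comm
  rw [h3, ← smul_eq_mul]
  exact Finset.sum_le_card_nsmul _ _ _ fun W hW =>
    card_solo_le hc hD hB hB' hx (hT hW) (hterm W hW)

/-- `h1` settles `t ≤ 0.32 D` and `h2` settles `x ≥ 0.18 D`. In the remaining range `t > x`, and
`h3` can be divided by `t - x`. -/
theorem large_card_arith {q x t β H D : ℕ} (hx : q + x = D) (hH : 1 ≤ H)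
    (h1 : β ≤ H * (x + t + 1)) (h2 : 2 * β ≤ H * max D (2 * (x + 1)))
    (h3 : β * t ≤ t * (H * (x + 1)) + β * x) : 100 * β ≤ H * (100 * x + 32 * D + 300) := by
  by_cases ht : 100 * t ≤ 32 * D
  · calc 100 * β ≤ H * (100 * x + 100 * t + 100) := by linarith
      _ ≤ _ := Nat.mul_le_mul_left _ (by omega)
  by_cases hxx : 18 * D ≤ 100 * x
  · have : 100 * β ≤ H * (50 * max D (2 * (x + 1))) := by
      calc 100 * β = 50 * (2 * β) := by ring
        _ ≤ 50 * (H * max D (2 * (x + 1))) := Nat.mul_le_mul_left _ h2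
        _ = _ := by ring
    refine this.trans (Nat.mul_le_mul_left _ ?_)
    omega
  · push Not at ht hxx
    zify at *
    have hpos : (0 : ℤ) < t - x := by linarith
    have h4 : (β : ℤ) * (t - x) ≤ H * (t * (x + 1)) := by linarith
    have h5 : (100 : ℤ) * (t * (x + 1)) ≤ (100 * x + 32 * D + 300) * (t - x) := by
      have e1 : (0 : ℤ) ≤ D := by positivity
      have e2 : (0 : ℤ) ≤ x := by positivity
      nlinarith [mul_nonneg e1 e2, mul_nonneg e1 (by linarith : (0 : ℤ) ≤ 100 * t - 32 * D),
        mul_nonneg e2 (by linarith : (0 : ℤ) ≤ 18 * D - 100 * x),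
        mul_nonneg e1 (by linarith : (0 : ℤ) ≤ 18 * D - 100 * x)]
    have h6 : (100 * β : ℤ) * (t - x) ≤ (H * (100 * x + 32 * D + 300)) * (t - x) := by
      calc (100 * β : ℤ) * (t - x) = 100 * (β * (t - x)) := by ring
        _ ≤ 100 * (H * (t * (x + 1))) := by linarith
        _ = H * (100 * (t * (x + 1))) := by ring
        _ ≤ H * ((100 * x + 32 * D + 300) * (t - x)) := by
          exact mul_le_mul_of_nonneg_left h5 (by positivity)
        _ = _ := by ring
    exact le_of_mul_le_mul_right h6 hpos

open Classical in
theorem exists_isProper (hD : ∀ x, (Finset.univ.filter fun w => G.Adj x w).card ≤ D) :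
    ∃ c : U → Fin (D + 1), IsProper G c := by
  suffices hs : ∀ s : Finset U, ∃ c : U → Fin (D + 1),
      ∀ u ∈ s, ∀ v ∈ s, G.Adj u v → c u ≠ c v by
    obtain ⟨c, hc⟩ := hs Finset.univ
    exact ⟨c, fun u v => hc u (Finset.mem_univ u) v (Finset.mem_univ v)⟩
  intro s
  induction s using Finset.induction_on with
  | empty => exact ⟨fun _ => 0, by simp⟩
  | insert a s ha ih =>
    obtain ⟨c, hc⟩ := ih
    obtain ⟨i, hi⟩ : ∃ i, i ∉ (Finset.univ.filter fun w => G.Adj a w).image c := by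
      by_contra hcon
      push Not at hcon
      have h1 := Finset.card_le_card (fun i _ => hcon i : Finset.univ ⊆ _)
      have h2 := (Finset.card_image_le (f := c) (s := Finset.univ.filter fun w => G.Adj a w)).trans
        (hD a)
      simp only [Finset.card_univ, Fintype.card_fin] at h1
      omega
    have hi' : ∀ w, G.Adj a w → c w ≠ i := fun w hw he => hi
      (Finset.mem_image.2 ⟨w, Finset.mem_filter.2 ⟨Finset.mem_univ w, hw⟩, he⟩)
    refine ⟨Function.update c a i, fun u hu v hv huv => ?_⟩
    by_cases hua : u = a
    · subst hua
      rw [Function.update_self, Function.update_of_ne huv.ne.symm]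
      exact (hi' v huv).symm
    · by_cases hva : v = a
      · subst hva
        rw [Function.update_self, Function.update_of_ne hua]
        exact hi' u huv.symm
      · rw [Function.update_of_ne hua, Function.update_of_ne hva]
        exact hc u (Finset.mem_of_mem_insert_of_ne hu hua) v
          (Finset.mem_of_mem_insert_of_ne hv hva) huv

-- Accessible classes and classes of size `h + 1` hold at most `h + 1` nodes each; the remaining
-- nodes form `B`, which the three counts bound. Inaccessible classes of size exactly `h + 1` are
-- too small for the exchange to lower the energy, so `hmid` requires them to be few.
open Classical in
theorem IsLeast.card_le {c : U → Fin (D + 1)} (hc : IsLeast G c)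
    (hD : ∀ x, (Finset.univ.filter fun w => G.Adj x w).card ≤ D)
    (hsink : ∃ i, (colorClass c i).card ≤ h)
    (hmid : 100 * (Finset.univ.filter fun i => (colorClass c i).card = h + 1).card ≤ D + 1) :
    100 * Fintype.card U ≤ (133 * D + 301) * (h + 1) := by
  set A := accessible G c h with hA
  set M := Finset.univ.filter fun i => (colorClass c i).card = h + 1 with hM
  set B := Finset.univ.filter fun y => c y ∉ A ∧ h + 2 ≤ (colorClass c (c y)).card with hBdef
  obtain ⟨i₀, hi₀⟩ := hsink
  have hAne : A.Nonempty := ⟨i₀, mem_accessible.2 ⟨_, Route.sink i₀ hi₀⟩⟩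
  have hB : ∀ y ∈ B, c y ∉ A := fun y hy => (Finset.mem_filter.1 hy).2.1
  have hB' : ∀ y ∈ B, h + 2 ≤ (colorClass c (c y)).card := fun y hy => (Finset.mem_filter.1 hy).2.2
  have hcount : Fintype.card U ≤ (A ∪ M).card * (h + 1) + B.card := by
    have hsplit : (Finset.univ : Finset U) ⊆ ((A ∪ M).biUnion fun i => colorClass c i) ∪ B := by
      intro y _
      rw [Finset.mem_union, Finset.mem_biUnion]
      by_cases hyA : c y ∈ A
      · exact Or.inl ⟨c y, Finset.mem_union_left _ hyA, mem_colorClass.2 rfl⟩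
      by_cases hyM : (colorClass c (c y)).card = h + 1
      · exact Or.inl ⟨c y, Finset.mem_union_right _
          (Finset.mem_filter.2 ⟨Finset.mem_univ _, hyM⟩), mem_colorClass.2 rfl⟩
      have : ¬ (colorClass c (c y)).card ≤ h := fun hle =>
        hyA (mem_accessible.2 ⟨_, Route.sink _ hle⟩)
      exact Or.inr (Finset.mem_filter.2 ⟨Finset.mem_univ _, hyA, by omega⟩)
    have h1 := (Finset.card_le_card hsplit).trans (Finset.card_union_le _ _)
    rw [Finset.card_univ] at h1
    refine h1.trans (Nat.add_le_add_right (Finset.card_biUnion_le_card_mul _ _ _ ?_) _)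
    intro i hi
    rcases Finset.mem_union.1 hi with hi | hi
    · obtain ⟨P, hr⟩ := mem_accessible.1 hi
      exact hc.card_le_of_route hr
    · exact (Finset.mem_filter.1 hi).2.le
  rcases Finset.eq_empty_or_nonempty B with hBe | ⟨y, hy⟩
  · have h1 : (A ∪ M).card ≤ D + 1 := by
      simpa using Finset.card_le_univ (A ∪ M)
    rw [hBe, Finset.card_empty, add_zero] at hcount
    calc 100 * Fintype.card U ≤ 100 * ((D + 1) * (h + 1)) :=
          Nat.mul_le_mul_left _ (hcount.trans (Nat.mul_le_mul_right _ h1))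
      _ = (100 * D + 100) * (h + 1) := by ring
      _ ≤ _ := Nat.mul_le_mul_right _ (by omega)
  · have hq : A.card ≤ D := by
      have := sum_colorDegree_add_card_le (c := c) hD y A ∅ (by simp)
      have h2 : A.card ≤ ∑ i ∈ A, colorDegree G c y i := by
        rw [Finset.card_eq_sum_ones]
        exact Finset.sum_le_sum fun W hW => one_le_colorDegree hB hy hW
      omega
    obtain ⟨x, hx⟩ := Nat.exists_eq_add_of_le hq
    obtain ⟨T, hT, hTne, E, hE, hterm, hiso⟩ := exists_terminal_family hAne
    have h1 := card_le_of_isolated_family hc hD hB hx.symm hT hTne hE hiso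
    obtain ⟨W, hW⟩ := hTne
    have h2 := two_mul_card_le hc hD hB hB' hx.symm (hT hW) (hterm W hW)
    have h3 := card_mul_card_le hc hD hB hB' hx.symm hT hterm
    have h4 := large_card_arith hx.symm (by omega) h1 h2 h3
    have h5 := Finset.card_union_le A M
    calc 100 * Fintype.card U ≤ 100 * ((A.card + M.card) * (h + 1) + B.card) :=
          Nat.mul_le_mul_left _ (hcount.trans
            (Nat.add_le_add_right (Nat.mul_le_mul_right _ h5) _))
      _ = (100 * A.card + 100 * M.card) * (h + 1) + 100 * B.card := by ring
      _ ≤ (100 * A.card + (D + 1)) * (h + 1) + (h + 1) * (100 * x + 32 * D + 300) := by gcongr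
      _ = (100 * (A.card + x) + 33 * D + 301) * (h + 1) := by ring
      _ = _ := by rw [← hx]; ring

open Classical in
/-- A graph of maximal degree at most `D` has a proper colouring with `D + 1` colours that is
balanced up to a factor of about `1.33`. -/
theorem exists_balanced_coloring
    (hD : ∀ x, (Finset.univ.filter fun w => G.Adj x w).card ≤ D) :
    ∃ c : U → Fin (D + 1), IsProper G c ∧
      ∀ i, 100 * Fintype.card U ≤ (133 * D + 301) * ((colorClass c i).card + 100) := by
  obtain ⟨c₀, hc₀⟩ := exists_isProper hD
  obtain ⟨c, hc, hmin⟩ := Finset.exists_min_image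
    (Finset.univ.filter fun c : U → Fin (D + 1) => IsProper G c) sizeEnergy
    ⟨c₀, by simpa using hc₀⟩
  have hleast : IsLeast G c := ⟨by simpa using hc, fun c' hc' => hmin c' (by simpa using hc')⟩
  refine ⟨c, hleast.1, fun i => ?_⟩
  set a := (colorClass c i).card
  -- The families of classes of size `a + 1, …, a + 100` are disjoint, so one has at most `(D + 1) /
  -- 100` members. The threshold is then `h = a + j`, at the price of the additive `100` in the
  -- conclusion.
  obtain ⟨j, hj, hmid⟩ : ∃ j ∈ Finset.range 100,
      100 * (Finset.univ.filter fun i => (colorClass c i).card = a + j + 1).card ≤ D + 1 := by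
    by_contra hcon
    push Not at hcon
    have h1 := Finset.sum_lt_sum_of_nonempty (by simp) hcon
    rw [← Finset.mul_sum, ← Finset.card_biUnion] at h1
    · have h2 := Finset.card_le_univ ((Finset.range 100).biUnion fun j =>
        Finset.univ.filter fun i => (colorClass c i).card = a + j + 1)
      simp only [Finset.sum_const, Finset.card_range, smul_eq_mul, Fintype.card_fin] at h1 h2
      omega
    · intro j _ j' _ hne
      change Disjoint _ _
      rw [Finset.disjoint_left]
      intro k hk hk'
      simp only [Finset.mem_filter] at hk hk'
      omega
  have h1 := hleast.card_le (h := a + j) hD ⟨i, by omega⟩ hmid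
  refine h1.trans (Nat.mul_le_mul_left _ ?_)
  have := Finset.mem_range.1 hj
  omega

end Balanced

/-! ### Perfect matchings in random bipartite relations -/

section Matching

/-- No element of `X` is related to an element of `Y`. -/
def Unrelated {α β : Type*} (r : α → β → Prop) (X : Finset α) (Y : Finset β) : Prop :=
  ∀ u ∈ X, ∀ v ∈ Y, ¬ r u v

open Classical in
/-- In a uniformly random relation `rel a`, `a ∈ Q`, there is no related pair in `X × Y` with
probability at most `(1 - p) ^ (|X| |Y|)`. -/
def IsSpread {Ω α β : Type*} (Q : Finset Ω) (rel : Ω → α → β → Prop) (p : ℝ) : Prop :=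
  ∀ (X : Finset α) (Y : Finset β),
    ((Q.filter fun a => Unrelated (rel a) X Y).card : ℝ) ≤
      (1 - p) ^ (X.card * Y.card) * Q.card

/-- The relation `r` contains the graph of an injective function. -/
def HasMatching {α β : Type*} (r : α → β → Prop) : Prop :=
  ∃ f : α → β, Function.Injective f ∧ ∀ u, r u (f u)

open Classical in
/-- The elements related to some element of `X`. -/
noncomputable def related {α β : Type*} [Fintype β] (r : α → β → Prop) (X : Finset α) : Finset β :=
  Finset.univ.filter fun v => ∃ u ∈ X, r u v

theorem mem_related {α β : Type*} [Fintype β] {r : α → β → Prop} {X : Finset α} {v : β} :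
    v ∈ related r X ↔ ∃ u ∈ X, r u v := by
  simp [related]

variable {Ω α β : Type*} {Q : Finset Ω} {rel : Ω → α → β → Prop} {p : ℝ}

theorem IsSpread.swap (hs : IsSpread Q rel p) : IsSpread Q (fun a v u => rel a u v) p := by
  classical
  intro X Y
  have h := hs Y X
  rw [mul_comm Y.card] at h
  have he : ∀ a, Unrelated (fun v u => rel a u v) X Y ↔ Unrelated (rel a) Y X := fun a =>
    ⟨fun h u hu v hv => h v hv u hu, fun h u hu v hv => h v hv u hu⟩
  simpa only [he] using h

variable [Fintype β]

/-- If each element of `β` is selected independently with probability `1 - z`, then `z ^ |R|` is the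
probability that the selection misses `R`. Averaging over `Q` leaves the probability that `X` is
unrelated to a fixed selection, and the binomial theorem sums the bounds. -/
theorem IsSpread.sum_pow_card_related_le (hs : IsSpread Q rel p)
    (X : Finset α) {z : ℝ} (hz0 : 0 ≤ z) (hz1 : z ≤ 1) :
    ∑ a ∈ Q, z ^ (related (rel a) X).card ≤
      ((1 - z) * (1 - p) ^ X.card + z) ^ Fintype.card β * Q.card := by
  classical
  have hexp : ∀ a ∈ Q, z ^ (related (rel a) X).card = ∑ Y : Finset β,
      (1 - z) ^ Y.card * z ^ (Fintype.card β - Y.card) *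
        (if Unrelated (rel a) X Y then 1 else 0) := by
    intro a _
    set R := related (rel a) X
    have h1 := Finset.sum_pow_mul_eq_add_pow (1 - z) z Rᶜ
    rw [sub_add_cancel, one_pow] at h1
    have h2 : ∀ Y : Finset β, Unrelated (rel a) X Y ↔ Y ⊆ Rᶜ := by
      intro Y
      constructor
      · intro h v hv
        rw [Finset.mem_compl, mem_related]
        rintro ⟨u, hu, huv⟩
        exact h u hu v hv huv
      · intro h u hu v hv huv
        exact Finset.mem_compl.1 (h hv) (mem_related.2 ⟨u, hu, huv⟩)
    simp only [h2, mul_ite, mul_one, mul_zero]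
    rw [← Finset.sum_filter]
    have h3 : (Finset.univ.filter fun Y : Finset β => Y ⊆ Rᶜ) = Rᶜ.powerset := by
      ext Y; simp
    rw [h3]
    calc z ^ R.card = z ^ R.card * ∑ Y ∈ Rᶜ.powerset,
          (1 - z) ^ Y.card * z ^ (Rᶜ.card - Y.card) := by rw [h1, mul_one]
      _ = _ := by
        rw [Finset.mul_sum]
        refine Finset.sum_congr rfl fun Y hY => ?_
        have h4 := Finset.card_le_card (Finset.mem_powerset.1 hY)
        have h5 := Finset.card_add_card_compl R
        rw [mul_left_comm, ← pow_add]
        congr 2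
        omega
  rw [Finset.sum_congr rfl hexp, Finset.sum_comm, ← Fintype.sum_pow_mul_eq_add_pow, Finset.sum_mul]
  refine Finset.sum_le_sum fun Y _ => ?_
  rw [← Finset.mul_sum, Finset.sum_boole]
  have hz : 0 ≤ 1 - z := by linarith
  calc _ ≤ (1 - z) ^ Y.card * z ^ (Fintype.card β - Y.card) *
        ((1 - p) ^ (X.card * Y.card) * Q.card) :=
        mul_le_mul_of_nonneg_left (hs X Y) (by positivity)
    _ = _ := by rw [mul_pow, ← pow_mul]; ring

-- Markov's inequality for `z ^ |related X|` with `z = 1 / 50`. For small `X`, a union bound over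
-- the possible neighbourhoods would cost extra powers of `k` that the available class sizes do not
-- cover.
open Classical in
theorem IsSpread.card_related_lt_le_of_small (hs : IsSpread Q rel p) (hp0 : 0 ≤ p) (hp1 : p ≤ 1)
    (X : Finset α) (hX : p * X.card ≤ 1 / 50) :
    ((Q.filter fun a => (related (rel a) X).card < X.card).card : ℝ) ≤
      (50 * Real.exp (-(0.96 * (Fintype.card β * p)))) ^ X.card * Q.card := by
  set x := X.card
  set k := Fintype.card β
  have h1 := hs.sum_pow_card_related_le X (z := 1 / 50) (by norm_num) (by norm_num)
  have h2 : (1 / 50 : ℝ) ^ x * (Q.filter fun a => (related (rel a) X).card < x).card ≤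
      ∑ a ∈ Q, (1 / 50 : ℝ) ^ (related (rel a) X).card := by
    refine le_trans ?_ (Finset.sum_le_sum_of_subset_of_nonneg (Finset.filter_subset
      (fun a => (related (rel a) X).card < x) Q) fun _ _ _ => by positivity)
    rw [mul_comm, ← nsmul_eq_mul]
    refine Finset.card_nsmul_le_sum _ _ _ fun a ha => ?_
    exact pow_le_pow_of_le_one (by norm_num) (by norm_num) (Finset.mem_filter.1 ha).2.le
  -- As `px ≤ 1/50`, the square in `exp(-px) ≤ 1 - px + (px)²` costs at most `0.02 px`. The exponent
  -- `0.96` comes from `0.98 · 0.98 = 0.9604`.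
  have hq : (1 - p) ^ x ≤ 1 - 0.98 * (p * x) := by
    have e1 : (1 - p) ^ x ≤ Real.exp (-(p * x)) := by
      calc (1 - p) ^ x ≤ Real.exp (-p) ^ x :=
            pow_le_pow_left₀ (by linarith) (Real.one_sub_le_exp_neg p) _
        _ = _ := by rw [← Real.exp_nat_mul]; ring_nf
    have e0 : 0 ≤ p * x := by positivity
    have e2 := Real.abs_exp_sub_one_sub_id_le (x := -(p * x)) (by
      rw [abs_neg, abs_of_nonneg e0]; linarith)
    have e3 := (abs_le.1 e2).2
    nlinarith
  have h3 : ((1 - 1 / 50 : ℝ) * (1 - p) ^ x + 1 / 50) ^ k ≤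
      Real.exp (-(0.96 * (k * p))) ^ x := by
    calc ((1 - 1 / 50 : ℝ) * (1 - p) ^ x + 1 / 50) ^ k ≤ Real.exp (-(0.96 * (p * x))) ^ k := by
          refine pow_le_pow_left₀ ?_ ?_ _
          · have : 0 ≤ (1 - p) ^ x := pow_nonneg (by linarith) _
            positivity
          · have e1 := Real.one_sub_le_exp_neg (0.96 * (p * x))
            have e0 : 0 ≤ p * x := by positivity
            linarith
      _ = _ := by
        rw [← Real.exp_nat_mul, ← Real.exp_nat_mul]; ring_nf
  have h4 := h2.trans (h1.trans (mul_le_mul_of_nonneg_right h3 (by positivity)))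
  rw [mul_pow]
  have h5 : (50 : ℝ) ^ x * ((1 / 50) ^ x) = 1 := by rw [← mul_pow]; norm_num
  calc _ = (50 : ℝ) ^ x * ((1 / 50 : ℝ) ^ x *
        (Q.filter fun a => (related (rel a) X).card < x).card) := by rw [← mul_assoc, h5, one_mul]
    _ ≤ 50 ^ x * (Real.exp (-(0.96 * (k * p))) ^ x * Q.card) := by gcongr
    _ = _ := by ring

theorem choose_le_exp_mul_div_pow {k x : ℕ} (hx : 1 ≤ x) :
    (k.choose x : ℝ) ≤ (Real.exp 1 * (k / x)) ^ x := by
  have h1 : (k.choose x : ℝ) ≤ k ^ x / x.factorial := Nat.choose_le_pow_div x k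
  have h2 := Real.pow_div_factorial_le_exp (x : ℝ) (by positivity) x
  have hx' : (0 : ℝ) < x := by exact_mod_cast hx
  refine h1.trans ?_
  have h3 : ((k : ℝ) / x) ^ x * (x ^ x / x.factorial) = k ^ x / x.factorial := by
    rw [div_pow]; field_simp
  rw [← h3, mul_pow, ← Real.exp_nat_mul, mul_one, mul_comm (Real.exp _)]
  gcongr

variable [Fintype α]

-- For `px ≤ 1/50` the moment bound is multiplied by at most `k ^ x` choices of `X`. Beyond that, `k
-- / x < 50kp` keeps both binomial coefficients below `(136kp) ^ x`, so a union bound over `X` and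
-- `k - x` elements unrelated to it is affordable.
open Classical in
theorem IsSpread.card_exists_related_lt_le (hs : IsSpread Q rel p) (hp0 : 0 ≤ p) (hp1 : p ≤ 1)
    {k x : ℕ} (hα : Fintype.card α = k) (hβ : Fintype.card β = k) (hk : 3 ≤ k) (hx1 : 1 ≤ x)
    (hx2 : 2 * x ≤ k + 1) :
    ((Q.filter fun a => ∃ X : Finset α, X.card = x ∧ (related (rel a) X).card < x).card : ℝ) ≤
      ((50 * k * Real.exp (-(0.96 * (k * p)))) ^ x +
        ((136 * (k * p)) ^ 2 * Real.exp (-(k * p / 3))) ^ x) * Q.card := by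
  rw [add_mul]
  have hr1 : 0 ≤ (50 * k * Real.exp (-(0.96 * (k * p)))) ^ x * Q.card := by positivity
  have hr2 : 0 ≤ ((136 * (k * p)) ^ 2 * Real.exp (-(k * p / 3))) ^ x * Q.card := by positivity
  by_cases hsmall : p * x ≤ 1 / 50
  · refine le_trans ?_ (le_add_of_nonneg_right hr2)
    have h1 : (Q.filter fun a => ∃ X : Finset α, X.card = x ∧ (related (rel a) X).card < x) ⊆
        (Finset.powersetCard x (Finset.univ : Finset α)).biUnion fun X =>
          Q.filter fun a => (related (rel a) X).card < X.card := by
      intro a ha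
      obtain ⟨haQ, X, hX, hlt⟩ := Finset.mem_filter.1 ha
      exact Finset.mem_biUnion.2 ⟨X, Finset.mem_powersetCard.2 ⟨Finset.subset_univ _, hX⟩,
        Finset.mem_filter.2 ⟨haQ, hX ▸ hlt⟩⟩
    have h2 : ((Q.filter fun a =>
        ∃ X : Finset α, X.card = x ∧ (related (rel a) X).card < x).card : ℝ) ≤
        ∑ X ∈ Finset.powersetCard x (Finset.univ : Finset α),
          ((Q.filter fun a => (related (rel a) X).card < X.card).card : ℝ) := by
      exact_mod_cast (Finset.card_le_card h1).trans Finset.card_biUnion_le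
    refine h2.trans (le_trans (Finset.sum_le_card_nsmul _ _
      ((50 * Real.exp (-(0.96 * (k * p)))) ^ x * Q.card) fun X hX => ?_) ?_)
    · have hXc := (Finset.mem_powersetCard.1 hX).2
      have := hs.card_related_lt_le_of_small hp0 hp1 X (by rw [hXc]; exact hsmall)
      rw [hβ] at this
      simpa only [hXc] using this
    · rw [Finset.card_powersetCard, Finset.card_univ, hα, nsmul_eq_mul, ← mul_assoc]
      refine mul_le_mul_of_nonneg_right ?_ (by positivity)
      calc (k.choose x : ℝ) * (50 * Real.exp (-(0.96 * (k * p)))) ^ x ≤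
            (k : ℝ) ^ x * (50 * Real.exp (-(0.96 * (k * p)))) ^ x := by
            gcongr; exact_mod_cast Nat.choose_le_pow k x
        _ = _ := by rw [← mul_pow]; ring
  · refine le_trans ?_ (le_add_of_nonneg_left hr1)
    push Not at hsmall
    have h1 : (Q.filter fun a => ∃ X : Finset α, X.card = x ∧ (related (rel a) X).card < x) ⊆
        (Finset.powersetCard x (Finset.univ : Finset α) ×ˢ
          Finset.powersetCard (k - x) (Finset.univ : Finset β)).biUnion fun XY =>
          Q.filter fun a => Unrelated (rel a) XY.1 XY.2 := by
      intro a ha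
      obtain ⟨haQ, X, hX, hlt⟩ := Finset.mem_filter.1 ha
      obtain ⟨Y, hY, hYc⟩ := Finset.exists_subset_card_eq (s := (related (rel a) X)ᶜ) (n := k - x)
        (by rw [Finset.card_compl, hβ]; omega)
      refine Finset.mem_biUnion.2 ⟨(X, Y), Finset.mem_product.2
        ⟨Finset.mem_powersetCard.2 ⟨Finset.subset_univ _, hX⟩,
          Finset.mem_powersetCard.2 ⟨Finset.subset_univ _, hYc⟩⟩,
        Finset.mem_filter.2 ⟨haQ, fun u hu v hv huv => ?_⟩⟩
      exact Finset.mem_compl.1 (hY hv) (mem_related.2 ⟨u, hu, huv⟩)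
    have h2 : ((Q.filter fun a =>
        ∃ X : Finset α, X.card = x ∧ (related (rel a) X).card < x).card : ℝ) ≤
        ∑ XY ∈ Finset.powersetCard x (Finset.univ : Finset α) ×ˢ
          Finset.powersetCard (k - x) (Finset.univ : Finset β),
          ((Q.filter fun a => Unrelated (rel a) XY.1 XY.2).card : ℝ) := by
      exact_mod_cast (Finset.card_le_card h1).trans Finset.card_biUnion_le
    refine h2.trans (le_trans (Finset.sum_le_card_nsmul _ _
      ((1 - p) ^ (x * (k - x)) * Q.card) fun XY hXY => ?_) ?_)
    · obtain ⟨hX, hY⟩ := Finset.mem_product.1 hXY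
      have := hs XY.1 XY.2
      rwa [(Finset.mem_powersetCard.1 hX).2, (Finset.mem_powersetCard.1 hY).2] at this
    · rw [Finset.card_product, Finset.card_powersetCard, Finset.card_powersetCard,
        Finset.card_univ, Finset.card_univ, hα, hβ, Nat.choose_symm (by omega : x ≤ k),
        nsmul_eq_mul, ← mul_assoc]
      refine mul_le_mul_of_nonneg_right ?_ (by positivity)
      have hx' : (0 : ℝ) < x := by exact_mod_cast hx1
      have e1 : (k.choose x : ℝ) ≤ (136 * (k * p)) ^ x := by
        refine (choose_le_exp_mul_div_pow hx1).trans (pow_le_pow_left₀ (by positivity) ?_ _)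
        have e2 : (k : ℝ) / x ≤ 50 * (k * p) := by
          rw [div_le_iff₀ hx']
          have : (0 : ℝ) ≤ k := by positivity
          nlinarith
        have e3 := Real.exp_one_lt_d9
        calc Real.exp 1 * (k / x) ≤ 2.72 * (50 * (k * p)) := by
              gcongr; linarith
          _ = 136 * (k * p) := by ring
      have e4 : (1 - p) ^ (x * (k - x)) ≤ Real.exp (-(k * p / 3)) ^ x := by
        calc (1 - p) ^ (x * (k - x)) ≤ Real.exp (-p) ^ (x * (k - x)) :=
              pow_le_pow_left₀ (by linarith) (Real.one_sub_le_exp_neg p) _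
          _ = (Real.exp (-p) ^ (k - x)) ^ x := by rw [mul_comm, pow_mul]
          _ ≤ _ := by
            refine pow_le_pow_left₀ (by positivity) ?_ _
            rw [← Real.exp_nat_mul, Real.exp_le_exp]
            have e5 : (k : ℝ) ≤ 3 * ((k - x : ℕ) : ℝ) := by
              exact_mod_cast (by omega : k ≤ 3 * (k - x))
            nlinarith
      push_cast
      calc (k.choose x : ℝ) * (k.choose x) * (1 - p) ^ (x * (k - x)) ≤
            (136 * (k * p)) ^ x * (136 * (k * p)) ^ x * Real.exp (-(k * p / 3)) ^ x := by
            have : 0 ≤ (1 - p) ^ (x * (k - x)) := pow_nonneg (by linarith) _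
            gcongr
        _ = _ := by rw [mul_pow _ (Real.exp _), ← pow_mul, mul_comm 2, pow_mul, sq, mul_pow]

theorem sum_pow_Ico_le {r : ℝ} (h0 : 0 ≤ r) (h1 : r ≤ 1 / 2) (n : ℕ) :
    ∑ x ∈ Finset.Ico 1 n, r ^ x ≤ 2 * r := by
  refine (geom_sum_Ico_le_of_lt_one h0 (by linarith)).trans ?_
  rw [pow_one, div_le_iff₀ (by linarith)]
  nlinarith

open Classical in
theorem IsSpread.card_exists_small_related_lt_le (hs : IsSpread Q rel p) (hp0 : 0 ≤ p)
    (hp1 : p ≤ 1) {k : ℕ} (hα : Fintype.card α = k) (hβ : Fintype.card β = k) (hk : 3 ≤ k)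
    (hr1 : 50 * k * Real.exp (-(0.96 * (k * p))) ≤ 1 / 2)
    (hr2 : (136 * (k * p)) ^ 2 * Real.exp (-(k * p / 3)) ≤ 1 / 2) :
    ((Q.filter fun a => ∃ X : Finset α, 2 * X.card ≤ k + 1 ∧
        (related (rel a) X).card < X.card).card : ℝ) ≤
      2 * (50 * k * Real.exp (-(0.96 * (k * p))) +
        (136 * (k * p)) ^ 2 * Real.exp (-(k * p / 3))) * Q.card := by
  have h1 : (Q.filter fun a => ∃ X : Finset α, 2 * X.card ≤ k + 1 ∧
      (related (rel a) X).card < X.card) ⊆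
      ((Finset.Ico 1 (k + 1)).filter fun x => 2 * x ≤ k + 1).biUnion fun x =>
        Q.filter fun a => ∃ X : Finset α, X.card = x ∧ (related (rel a) X).card < x := by
    intro a ha
    obtain ⟨haQ, X, hX, hlt⟩ := Finset.mem_filter.1 ha
    exact Finset.mem_biUnion.2 ⟨X.card, Finset.mem_filter.2 ⟨Finset.mem_Ico.2 (by omega), hX⟩,
      Finset.mem_filter.2 ⟨haQ, X, rfl, hlt⟩⟩
  have h2 : ((Q.filter fun a => ∃ X : Finset α, 2 * X.card ≤ k + 1 ∧
      (related (rel a) X).card < X.card).card : ℝ) ≤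
      ∑ x ∈ (Finset.Ico 1 (k + 1)).filter fun x => 2 * x ≤ k + 1, ((Q.filter fun a =>
        ∃ X : Finset α, X.card = x ∧ (related (rel a) X).card < x).card : ℝ) := by
    exact_mod_cast (Finset.card_le_card h1).trans Finset.card_biUnion_le
  refine h2.trans ?_
  set r1 := 50 * k * Real.exp (-(0.96 * (k * p))) with hr1def
  set r2 := (136 * (k * p)) ^ 2 * Real.exp (-(k * p / 3)) with hr2def
  have p1 : 0 ≤ r1 := by positivity
  have p2 : 0 ≤ r2 := by positivity
  calc _ ≤ ∑ x ∈ (Finset.Ico 1 (k + 1)).filter fun x => 2 * x ≤ k + 1,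
        (r1 ^ x + r2 ^ x) * (Q.card : ℝ) := by
        refine Finset.sum_le_sum fun x hx => ?_
        simp only [Finset.mem_filter, Finset.mem_Ico] at hx
        exact hs.card_exists_related_lt_le hp0 hp1 hα hβ hk hx.1.1 hx.2
    _ ≤ ∑ x ∈ Finset.Ico 1 (k + 1), (r1 ^ x + r2 ^ x) * (Q.card : ℝ) :=
        Finset.sum_le_sum_of_subset_of_nonneg (Finset.filter_subset _ _)
          fun _ _ _ => by positivity
    _ = (∑ x ∈ Finset.Ico 1 (k + 1), r1 ^ x + ∑ x ∈ Finset.Ico 1 (k + 1), r2 ^ x) * Q.card := by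
        rw [← Finset.sum_mul, Finset.sum_add_distrib]
    _ ≤ (2 * r1 + 2 * r2) * Q.card := by
        gcongr
        · exact sum_pow_Ico_le p1 hr1 _
        · exact sum_pow_Ico_le p2 hr2 _
    _ = _ := by ring

/-- By Hall's theorem, a failing matching has a deficient set of at most half the size, on one of
the two sides. -/
theorem exists_small_deficient {k : ℕ} (hα : Fintype.card α = k) (hβ : Fintype.card β = k)
    (r : α → β → Prop) (hno : ¬ HasMatching r) :
    (∃ X : Finset α, 2 * X.card ≤ k + 1 ∧ (related r X).card < X.card) ∨
      ∃ Y : Finset β, 2 * Y.card ≤ k + 1 ∧ (related (fun v u => r u v) Y).card < Y.card := by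
  classical
  rw [HasMatching, ← Fintype.all_card_le_filter_rel_iff_exists_injective] at hno
  push Not at hno
  obtain ⟨X, hX⟩ := hno
  have hX' : (related r X).card < X.card := by
    have he : related r X = Finset.univ.filter fun v => ∃ u ∈ X, r u v := by
      ext v; simp [related]
    rwa [he]
  by_cases hXs : 2 * X.card ≤ k + 1
  · exact Or.inl ⟨X, hXs, hX'⟩
  · right
    have hXk : X.card ≤ k := hα ▸ Finset.card_le_univ X
    -- `Y` has one element more than the complement of `X`, which contains everything related to
    -- `Y`. It is small because `X` is large.
    obtain ⟨Y, hY, hYc⟩ := Finset.exists_subset_card_eq (s := (related r X)ᶜ)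
      (n := k - X.card + 1) (by rw [Finset.card_compl, hβ]; omega)
    refine ⟨Y, by omega, ?_⟩
    have hsub : related (fun v u => r u v) Y ⊆ Xᶜ := by
      intro u hu
      obtain ⟨v, hv, huv⟩ := mem_related.1 hu
      exact Finset.mem_compl.2 fun huX => Finset.mem_compl.1 (hY hv) (mem_related.2 ⟨u, huX, huv⟩)
    have := Finset.card_le_card hsub
    rw [Finset.card_compl, hα] at this
    omega

open Classical in
theorem IsSpread.card_no_matching_le (hs : IsSpread Q rel p) (hp0 : 0 ≤ p) (hp1 : p ≤ 1) {k : ℕ}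
    (hα : Fintype.card α = k) (hβ : Fintype.card β = k) :
    ((Q.filter fun a => ¬ HasMatching (rel a)).card : ℝ) ≤
      4 * (50 * k * Real.exp (-(0.96 * (k * p))) +
        (136 * (k * p)) ^ 2 * Real.exp (-(k * p / 3))) * Q.card := by
  set r1 := 50 * k * Real.exp (-(0.96 * (k * p))) with hr1def
  set r2 := (136 * (k * p)) ^ 2 * Real.exp (-(k * p / 3)) with hr2def
  have p1 : 0 ≤ r1 := by positivity
  have p2 : 0 ≤ r2 := by positivity
  have htriv : 1 ≤ 4 * (r1 + r2) → ((Q.filter fun a =>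
      ¬ HasMatching (rel a)).card : ℝ) ≤
      4 * (r1 + r2) * Q.card := by
    intro h
    refine le_trans (b := (Q.card : ℝ)) (by exact_mod_cast Finset.card_filter_le _ _) ?_
    exact le_mul_of_one_le_left (by positivity) h
  rcases Nat.eq_zero_or_pos k with rfl | hkpos
  · have : IsEmpty α := Fintype.card_eq_zero_iff.1 hα
    have : (Q.filter fun a => ¬ HasMatching (rel a)) = ∅ := by
      refine Finset.filter_eq_empty_iff.2 fun a _ => not_not.2 ?_
      exact ⟨isEmptyElim, fun u => isEmptyElim u, fun u => isEmptyElim u⟩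
    rw [this, Finset.card_empty, Nat.cast_zero]
    positivity
  by_cases h1 : r1 ≤ 1 / 2
  swap
  · exact htriv (by linarith)
  by_cases h2 : r2 ≤ 1 / 2
  swap
  · exact htriv (by linarith)
  by_cases hk : 3 ≤ k
  swap
  -- For `k ≤ 2` the bound is trivial, since `r1 ≥ 50 exp(-2) ≥ 1`.
  · refine htriv ?_
    have e1 : (1 : ℝ) ≤ k := by exact_mod_cast hkpos
    have e2 : (k : ℝ) ≤ 2 := by exact_mod_cast (by omega : k ≤ 2)
    have e3 : Real.exp (-2) ≤ Real.exp (-(0.96 * (k * p))) := by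
      rw [Real.exp_le_exp]; nlinarith
    have e4 : (1 / 50 : ℝ) ≤ Real.exp (-2) := by
      rw [Real.exp_neg, one_div]
      refine inv_anti₀ (Real.exp_pos _) ?_
      have : Real.exp 2 = Real.exp 1 ^ 2 := by rw [← Real.exp_nat_mul]; norm_num
      have h3 := Real.exp_one_lt_d9
      have h4 := Real.exp_pos 1
      rw [this]; nlinarith
    have : 1 ≤ r1 := by rw [hr1def]; nlinarith
    linarith
  have h3 := hs.card_exists_small_related_lt_le hp0 hp1 hα hβ hk h1 h2
  have h4 := hs.swap.card_exists_small_related_lt_le hp0 hp1 hβ hα hk h1 h2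
  have h5 : (Q.filter fun a => ¬ HasMatching (rel a)) ⊆
      (Q.filter fun a => ∃ X : Finset α, 2 * X.card ≤ k + 1 ∧
        (related (rel a) X).card < X.card) ∪
      (Q.filter fun a => ∃ Y : Finset β, 2 * Y.card ≤ k + 1 ∧
        (related (fun v u => rel a u v) Y).card < Y.card) := by
    intro a ha
    obtain ⟨haQ, hno⟩ := Finset.mem_filter.1 ha
    rw [Finset.mem_union, Finset.mem_filter, Finset.mem_filter]
    exact (exists_small_deficient hα hβ (rel a) hno).imp (⟨haQ, ·⟩) (⟨haQ, ·⟩)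
  have h6 : ((Q.filter fun a =>
      ¬ HasMatching (rel a)).card : ℝ) ≤
      ((Q.filter fun a => ∃ X : Finset α, 2 * X.card ≤ k + 1 ∧
        (related (rel a) X).card < X.card).card : ℝ) +
      ((Q.filter fun a => ∃ Y : Finset β, 2 * Y.card ≤ k + 1 ∧
        (related (fun v u => rel a u v) Y).card < Y.card).card : ℝ) := by
    exact_mod_cast (Finset.card_le_card h5).trans (Finset.card_union_le _ _)
  rw [← hr1def, ← hr2def] at h3 h4
  calc _ ≤ _ := h6
    _ ≤ 2 * (r1 + r2) * Q.card + 2 * (r1 + r2) * Q.card := add_le_add h3 h4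
    _ = _ := by ring

end Matching

/-! ### Uniform tables and disjoint blocks of entries -/

section Tables

/-- Membership in `Q` does not depend on the coordinates in `T`. -/
def InvariantOn {I : Type*} (T : Finset I) (Q : Finset (I → Bool)) : Prop :=
  ∀ a b, (∀ i, i ∉ T → a i = b i) → a ∈ Q → b ∈ Q

theorem InvariantOn.mono {I : Type*} {T T' : Finset I} {Q : Finset (I → Bool)}
    (hQ : InvariantOn T Q) (hT : T' ⊆ T) : InvariantOn T' Q :=
  fun a b hab => hQ a b fun i hi => hab i fun hmem => hi (hT hmem)

/-- The tables `a` and `p` agree on `T`. -/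
def AgreeOn {I : Type*} (T : Finset I) (a p : I → Bool) : Prop := ∀ i ∈ T, a i = p i

-- Overwriting the entries in `T` by those of `p` stays inside `Q` and is at most `2 ^ |T|` to one.
open Classical in
theorem InvariantOn.card_le {I : Type*} {T : Finset I} {Q : Finset (I → Bool)}
    (hQ : InvariantOn T Q) (p : I → Bool) :
    Q.card ≤ 2 ^ T.card * (Q.filter fun a => AgreeOn T a p).card := by
  refine Finset.card_le_mul_card_image_of_maps_to (f := fun a => T.piecewise p a) ?_ _ ?_
  · intro a ha
    refine Finset.mem_filter.2 ⟨hQ a _ (fun i hi => ?_) ha, fun i hi => ?_⟩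
    · simp [hi]
    · simp [hi]
  · intro b _
    rw [← Finset.card_powerset]
    refine Finset.card_le_card_of_injOn (fun a => T.filter fun i => a i = true) ?_ ?_
    · exact fun a _ => Finset.mem_coe.2 (Finset.mem_powerset.2 (Finset.filter_subset _ _))
    · intro a ha a' ha' he
      simp only [Finset.coe_filter, Set.mem_ofPred_eq] at ha ha'
      funext i
      by_cases hi : i ∈ T
      · have := Finset.ext_iff.1 he i
        simp only [Finset.mem_filter, hi, true_and] at this
        exact Bool.eq_iff_iff.2 this
      · have := congrFun (ha.2.trans ha'.2.symm) i
        simpa [hi] using this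

/-- The table `a` differs from the pattern `p j` on the block `T j`, for all `j ∈ J`. -/
def Avoids {I κ : Type*} (J : Finset κ) (T : κ → Finset I) (p : κ → I → Bool) (a : I → Bool) :
    Prop := ∀ j ∈ J, ¬ AgreeOn (T j) a (p j)

open Classical in
/-- The probability that a random table differs from prescribed patterns on each of a family of
disjoint blocks of coordinates. -/
theorem card_avoid_le {I κ : Type*} {Q : Finset (I → Bool)} {J : Finset κ} {T : κ → Finset I}
    {p : κ → I → Bool} {s : ℕ} (hQ : ∀ j ∈ J, InvariantOn (T j) Q)
    (hdisj : ∀ j ∈ J, ∀ j' ∈ J, j ≠ j' → Disjoint (T j) (T j'))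
    (hs : ∀ j ∈ J, (T j).card ≤ s) :
    ((Q.filter fun a => Avoids J T p a).card : ℝ) ≤
      (1 - ((2 : ℝ) ^ s)⁻¹) ^ J.card * Q.card := by
  induction J using Finset.induction_on with
  | empty => simp [Avoids]
  | insert j J hj ih =>
    specialize ih (fun j' hj' => hQ j' (Finset.mem_insert_of_mem hj'))
      (fun j₁ h₁ j₂ h₂ => hdisj j₁ (Finset.mem_insert_of_mem h₁) j₂ (Finset.mem_insert_of_mem h₂))
      (fun j' hj' => hs j' (Finset.mem_insert_of_mem hj'))
    set Q' := Q.filter fun a => Avoids J T p a with hQ'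
    -- Avoidance on the earlier blocks involves no entry of `T j`, so block `j` remains uniform
    -- after conditioning on it.
    have hinv : InvariantOn (T j) Q' := by
      intro a b hab ha
      obtain ⟨haQ, hav⟩ := Finset.mem_filter.1 ha
      refine Finset.mem_filter.2 ⟨hQ j (Finset.mem_insert_self _ _) a b hab haQ, ?_⟩
      intro j' hj' hag
      refine hav j' hj' fun i hi => ?_
      have hd := hdisj j' (Finset.mem_insert_of_mem hj') j (Finset.mem_insert_self _ _)
        (fun he => hj (he ▸ hj'))
      rw [hab i (Finset.disjoint_left.1 hd hi), hag i hi]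
    have h1 := hinv.card_le (p j)
    have h2 : (Q.filter fun a => Avoids (insert j J) T p a) =
        Q'.filter fun a => ¬ AgreeOn (T j) a (p j) := by
      ext a
      rw [hQ', Finset.mem_filter, Finset.mem_filter, Finset.mem_filter]
      simp only [Avoids, Finset.mem_insert, forall_eq_or_imp]
      tauto
    have h3 := Finset.card_filter_add_card_filter_not (s := Q') fun a => AgreeOn (T j) a (p j)
    rw [h2, Finset.card_insert_of_notMem hj, pow_succ', mul_assoc]
    have hq0 : (0 : ℝ) ≤ 1 - ((2 : ℝ) ^ s)⁻¹ := by
      rw [sub_nonneg]; exact inv_le_one_of_one_le₀ (one_le_pow₀ (by norm_num))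
    refine le_trans ?_ (mul_le_mul_of_nonneg_left ih hq0)
    have h4 : (Q'.card : ℝ) ≤ 2 ^ s * (Q'.filter fun a => AgreeOn (T j) a (p j)).card := by
      have h5 : (Q'.card : ℝ) ≤
          2 ^ (T j).card * (Q'.filter fun a => AgreeOn (T j) a (p j)).card := by exact_mod_cast h1
      refine h5.trans (mul_le_mul_of_nonneg_right ?_ (by positivity))
      exact pow_le_pow_right₀ (by norm_num) (hs j (Finset.mem_insert_self _ _))
    have h6 : ((2 : ℝ) ^ s)⁻¹ * Q'.card ≤ (Q'.filter fun a => AgreeOn (T j) a (p j)).card := by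
      rw [inv_mul_le_iff₀ (by positivity)]; exact h4
    have h7 : ((Q'.filter fun a => AgreeOn (T j) a (p j)).card : ℝ) +
        (Q'.filter fun a => ¬ AgreeOn (T j) a (p j)).card = Q'.card := by exact_mod_cast h3
    linarith

end Tables

/-! ### Embedding level by level -/

section Levels

variable {V : Type*} [Fintype V]

/-- A partition of the nodes of `F` into levels, to be embedded one after the other: level `0` is
`S`, the other levels are uniform in loops, and distinct nodes of such a level are neither connected
nor have a common neighbour. -/
structure IsLevelling (F : Digraph V) (S : Set V) (lev : V → ℕ) : Prop where
  zero_iff : ∀ v, lev v = 0 ↔ v ∈ S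
  loop : ∀ u v, lev u = lev v → lev u ≠ 0 → (F.Adj u u ↔ F.Adj v v)
  indep : ∀ u v, lev u = lev v → lev u ≠ 0 → ¬ Connected F u v
  common : ∀ u v w, lev u = lev v → lev u ≠ 0 → Connected F u w → Connected F v w → u = v

/-- `g` is a level-preserving permutation that embeds the levels up to `i` of `F` into the digraph
with table `a`. -/
structure EmbedsUpTo (F : Digraph V) (lev : V → ℕ) (i : ℕ) (a : V × V → Bool)
    (g : Equiv.Perm V) : Prop where
  lev_eq : ∀ v, lev (g v) = lev v
  fix : ∀ v, lev v = 0 → g v = v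
  edge : ∀ u w, lev w < lev u → lev u ≤ i → Connected F u w →
    (a (g u, g w) = true ↔ F.Adj u w) ∧ (a (g w, g u) = true ↔ F.Adj w u)

open Classical in
/-- The pairs joining level `i` to a lower level. -/
noncomputable def freshPairs (lev : V → ℕ) (i : ℕ) : Finset (V × V) :=
  Finset.univ.filter fun e => (lev e.1 = i ∧ lev e.2 < i) ∨ (lev e.2 = i ∧ lev e.1 < i)

variable {F : Digraph V} {S : Set V} {lev : V → ℕ} {i d : ℕ}

theorem mem_freshPairs {e : V × V} : e ∈ freshPairs lev i ↔
    (lev e.1 = i ∧ lev e.2 < i) ∨ (lev e.2 = i ∧ lev e.1 < i) := by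
  simp [freshPairs]

/-- Since `g` preserves levels, the embedding up to level `i` never reads the entries joining level
`i + 1` to lower ones; they stay random for the next step. -/
theorem EmbedsUpTo.congr {a b : V × V → Bool} {g : Equiv.Perm V} (hg : EmbedsUpTo F lev i a g)
    (hab : ∀ e, e ∉ freshPairs lev (i + 1) → a e = b e) : EmbedsUpTo F lev i b g := by
  refine ⟨hg.lev_eq, hg.fix, fun u w hwu hu hc => ?_⟩
  have h := hg.edge u w hwu hu hc
  rwa [hab (g u, g w), hab (g w, g u)] at h
  all_goals
    rw [mem_freshPairs]
    simp only [hg.lev_eq]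
    omega

/-- `v` is a possible image of the node `u` of level `i`, given the images of the lower levels. -/
def Fits (F : Digraph V) (lev : V → ℕ) (i : ℕ) (g : Equiv.Perm V) (a : V × V → Bool)
    (u v : {v : V // lev v = i}) : Prop :=
  ∀ w, lev w < i → Connected F u w →
    (a (v, g w) = true ↔ F.Adj u w) ∧ (a (g w, v) = true ↔ F.Adj w u)

theorem EmbedsUpTo.extend {a : V × V → Bool} {g : Equiv.Perm V} (hg : EmbedsUpTo F lev i a g)
    {f : {v : V // lev v = i + 1} → {v : V // lev v = i + 1}} (hf : Function.Injective f)
    (hfit : ∀ u, Fits F lev (i + 1) g a u (f u)) : ∃ g', EmbedsUpTo F lev (i + 1) a g' := by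
  classical
  let φ : V → V := fun v => if hv : lev v = i + 1 then f ⟨v, hv⟩ else g v
  have hφ1 : ∀ v (hv : lev v = i + 1), φ v = f ⟨v, hv⟩ := fun v hv => dif_pos hv
  have hφ2 : ∀ v, lev v ≠ i + 1 → φ v = g v := fun v hv => dif_neg hv
  have hlev : ∀ v, lev (φ v) = lev v := by
    intro v
    by_cases hv : lev v = i + 1
    · rw [hφ1 v hv, (f ⟨v, hv⟩).2, hv]
    · rw [hφ2 v hv, hg.lev_eq]
  have hinj : Function.Injective φ := by
    intro u v huv
    have hl : lev u = lev v := by rw [← hlev u, huv, hlev v]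
    by_cases hv : lev v = i + 1
    · have hu := hl.trans hv
      rw [hφ1 u hu, hφ1 v hv] at huv
      exact congrArg Subtype.val (hf (Subtype.ext huv))
    · have hu : lev u ≠ i + 1 := hl ▸ hv
      rw [hφ2 u hu, hφ2 v hv] at huv
      exact g.injective huv
  refine ⟨Equiv.ofBijective φ (Finite.injective_iff_bijective.1 hinj), hlev, ?_, ?_⟩
  · intro v hv
    change φ v = v
    rw [hφ2 v (by omega), hg.fix v hv]
  · intro u w hwu hu hc
    change (a (φ u, φ w) = true ↔ _) ∧ (a (φ w, φ u) = true ↔ _)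
    rw [hφ2 w (by omega)]
    by_cases hu' : lev u = i + 1
    · rw [hφ1 u hu']
      exact hfit ⟨u, hu'⟩ w (by omega) hc
    · rw [hφ2 u hu']
      exact hg.edge u w hwu (by omega) hc

open Classical in
/-- The lower neighbours of `u`. -/
noncomputable def lowerNbrs (F : Digraph V) (lev : V → ℕ) (i : ℕ) (u : V) : Finset V :=
  Finset.univ.filter fun w => lev w < i ∧ Connected F u w

theorem mem_lowerNbrs {u w : V} : w ∈ lowerNbrs F lev i u ↔ lev w < i ∧ Connected F u w := by
  simp [lowerNbrs]

theorem card_lowerNbrs_le (hdeg : ∀ u, nodeDegree F u ≤ d) (u : V) :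
    (lowerNbrs F lev i u).card ≤ d := by
  refine le_trans ?_ (hdeg u)
  rw [nodeDegree, ← Set.ncard_coe_finset]
  exact Set.ncard_le_ncard (fun w hw => (mem_lowerNbrs.1 hw).2) (Set.toFinite _)

/-- Fitting `u` to `v` prescribes at most `2d` entries. Such an entry determines `v` and a lower
neighbour `w` of `u`, and `w` determines `u` because nodes of a level share no neighbour. So
distinct pairs have disjoint blocks and `card_avoid_le` applies. -/
theorem isSpread_fits (hl : IsLevelling F S lev) (hdeg : ∀ u, nodeDegree F u ≤ d) (hi : i ≠ 0)
    {g : Equiv.Perm V} (hg : ∀ v, lev (g v) = lev v) {Q : Finset (V × V → Bool)}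
    (hQ : InvariantOn (freshPairs lev i) Q) :
    IsSpread Q (Fits F lev i g) (((4 : ℝ) ^ d)⁻¹) := by
  classical
  intro X Y
  let T : {v : V // lev v = i} × {v : V // lev v = i} → Finset (V × V) := fun j =>
    (lowerNbrs F lev i j.1).image (fun w => ((j.2 : V), g w)) ∪
      (lowerNbrs F lev i j.1).image (fun w => (g w, (j.2 : V)))
  have hT : ∀ j e, e ∈ T j ↔ (∃ w, lev w < i ∧ Connected F j.1 w ∧ ((j.2 : V), g w) = e) ∨
      ∃ w, lev w < i ∧ Connected F j.1 w ∧ (g w, (j.2 : V)) = e := by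
    intro j e
    simp only [T, Finset.mem_union, Finset.mem_image, mem_lowerNbrs, and_assoc]
  let p : {v : V // lev v = i} × {v : V // lev v = i} → V × V → Bool := fun j e =>
    if e.1 = j.2 then decide (F.Adj j.1 (g.symm e.2)) else decide (F.Adj (g.symm e.1) j.1)
  have hsub : ∀ j, T j ⊆ freshPairs lev i := by
    intro j e he
    rw [mem_freshPairs]
    rcases (hT j e).1 he with ⟨w, hw, -, rfl⟩ | ⟨w, hw, -, rfl⟩
    · exact Or.inl ⟨j.2.2, by rw [hg]; exact hw⟩
    · exact Or.inr ⟨j.2.2, by rw [hg]; exact hw⟩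
  have hne : ∀ (v : {v : V // lev v = i}) w, lev w < i → g w ≠ v := by
    intro v w hw he
    have := v.2
    rw [← he, hg] at this
    omega
  have huniq : ∀ (u u' : {v : V // lev v = i}) w, Connected F u w → Connected F u' w → u = u' :=
    fun u u' w h h' => Subtype.ext (hl.common u u' w (u.2.trans u'.2.symm) (by rw [u.2]; exact hi)
      h h')
  have hav := card_avoid_le (Q := Q) (J := X ×ˢ Y) (T := T) (p := p) (s := 2 * d)
    (fun j _ => hQ.mono (hsub j)) ?_ ?_
  · rw [Finset.card_product, pow_mul (2 : ℝ), show (2 : ℝ) ^ 2 = 4 by norm_num] at hav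
    refine le_trans ?_ hav
    have : (Q.filter fun a => Unrelated (Fits F lev i g a) X Y) ⊆
        Q.filter fun a => Avoids (X ×ˢ Y) T p a := by
      intro a ha
      obtain ⟨haQ, hun⟩ := Finset.mem_filter.1 ha
      refine Finset.mem_filter.2 ⟨haQ, fun j hj hag => ?_⟩
      obtain ⟨h1, h2⟩ := Finset.mem_product.1 hj
      refine hun j.1 h1 j.2 h2 fun w hw hc => ⟨?_, ?_⟩
      · rw [hag _ ((hT _ _).2 (Or.inl ⟨w, hw, hc, rfl⟩))]
        simp [p]
      · rw [hag _ ((hT _ _).2 (Or.inr ⟨w, hw, hc, rfl⟩))]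
        simp [p, hne j.2 w hw]
    exact_mod_cast Finset.card_le_card this
  · intro j _ j' _ hjj
    rw [Finset.disjoint_left]
    intro e he he'
    refine hjj ?_
    rcases (hT j e).1 he with ⟨w, hw, hc, rfl⟩ | ⟨w, hw, hc, rfl⟩ <;>
    rcases (hT j' _).1 he' with ⟨w', hw', hc', h⟩ | ⟨w', hw', hc', h⟩ <;>
    rw [Prod.mk.injEq] at h
    · obtain rfl := g.injective h.2
      exact Prod.ext (huniq _ _ _ hc hc') (Subtype.ext h.1.symm)
    · exact absurd h.1 (hne _ _ hw')
    · exact absurd h.2 (hne _ _ hw')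
    · obtain rfl := g.injective h.1
      exact Prod.ext (huniq _ _ _ hc hc') (Subtype.ext h.2.symm)
  · intro j _
    have h1 := card_lowerNbrs_le (lev := lev) (i := i) hdeg (j.1 : V)
    refine (Finset.card_union_le _ _).trans ?_
    have h2 := Finset.card_image_le (s := lowerNbrs F lev i j.1) (f := fun w => ((j.2 : V), g w))
    have h3 := Finset.card_image_le (s := lowerNbrs F lev i j.1) (f := fun w => (g w, (j.2 : V)))
    omega

/-- The bound for the probability that a level of `k` nodes cannot be embedded. -/
noncomputable def failBound (k d : ℕ) : ℝ :=
  4 * (50 * k * Real.exp (-(0.96 * (k * ((4 : ℝ) ^ d)⁻¹))) +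
    (136 * (k * ((4 : ℝ) ^ d)⁻¹)) ^ 2 * Real.exp (-(k * ((4 : ℝ) ^ d)⁻¹ / 3)))

theorem failBound_nonneg (k d : ℕ) : 0 ≤ failBound k d := by
  unfold failBound; positivity

-- All entries except the fresh ones are revealed by `mask`. On a fibre of `mask` one embedding `g`
-- of the lower levels serves every table, so failure there means that the random relation `Fits`
-- for this fixed `g` has no matching.
open Classical in
theorem card_fail_step_le (hl : IsLevelling F S lev) (hdeg : ∀ u, nodeDegree F u ≤ d)
    {Q : Finset (V × V → Bool)} (hQ : InvariantOn (freshPairs lev (i + 1)) Q) :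
    ((Q.filter fun a => (∃ g, EmbedsUpTo F lev i a g) ∧
        ¬ ∃ g, EmbedsUpTo F lev (i + 1) a g).card : ℝ) ≤
      failBound (Fintype.card {v : V // lev v = i + 1}) d * Q.card := by
  set bad := Q.filter fun a => (∃ g, EmbedsUpTo F lev i a g) ∧
    ¬ ∃ g, EmbedsUpTo F lev (i + 1) a g with hbad
  let mask : (V × V → Bool) → (V × V → Bool) := fun a e =>
    if e ∈ freshPairs lev (i + 1) then false else a e
  have hmask : ∀ a b, mask a = mask b ↔ ∀ e, e ∉ freshPairs lev (i + 1) → a e = b e := by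
    intro a b
    constructor
    · intro h e he
      simpa [mask, he] using congrFun h e
    · intro h
      funext e
      by_cases he : e ∈ freshPairs lev (i + 1)
      · simp [mask, he]
      · simpa [mask, he] using h e he
  rw [Finset.card_eq_sum_card_fiberwise (f := mask) (s := bad) (t := Finset.univ)
      (fun _ _ => Finset.mem_univ _),
    Finset.card_eq_sum_card_fiberwise (f := mask) (s := Q) (t := Finset.univ)
      (fun _ _ => Finset.mem_univ _)]
  push_cast
  rw [Finset.mul_sum]
  refine Finset.sum_le_sum fun b _ => ?_
  rcases Finset.eq_empty_or_nonempty (bad.filter fun a => mask a = b) with he | ⟨a₀, ha₀⟩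
  · rw [he, Finset.card_empty, Nat.cast_zero]
    exact mul_nonneg (failBound_nonneg _ _) (by positivity)
  obtain ⟨ha₀b, rfl⟩ := Finset.mem_filter.1 ha₀
  obtain ⟨-, ⟨g, hg⟩, -⟩ := Finset.mem_filter.1 ha₀b
  have hinv : InvariantOn (freshPairs lev (i + 1)) (Q.filter fun a => mask a = mask a₀) := by
    intro a b hab ha
    obtain ⟨haQ, han⟩ := Finset.mem_filter.1 ha
    exact Finset.mem_filter.2 ⟨hQ a b hab haQ, ((hmask a b).2 hab).symm.trans han⟩
  have hspread := isSpread_fits hl hdeg (Nat.succ_ne_zero i) hg.lev_eq hinv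
  have h4 : (1 : ℝ) ≤ 4 ^ d := one_le_pow₀ (by norm_num)
  have hmatch := hspread.card_no_matching_le (by positivity) (inv_le_one_of_one_le₀ h4) rfl rfl
  rw [← failBound] at hmatch
  refine le_trans ?_ hmatch
  have : (bad.filter fun a => mask a = mask a₀) ⊆ (Q.filter fun a => mask a = mask a₀).filter
      fun a => ¬ HasMatching (Fits F lev (i + 1) g a) := by
    intro a ha
    obtain ⟨hab, han⟩ := Finset.mem_filter.1 ha
    obtain ⟨haQ, -, hno⟩ := Finset.mem_filter.1 hab
    refine Finset.mem_filter.2 ⟨Finset.mem_filter.2 ⟨haQ, han⟩, ?_⟩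
    rintro ⟨f, hf, hfit⟩
    exact hno ((hg.congr ((hmask a₀ a).1 han.symm)).extend hf hfit)
  exact Nat.cast_le.2 (Finset.card_le_card this)

open Classical in
theorem card_fail_le (hl : IsLevelling F S lev) (hdeg : ∀ u, nodeDegree F u ≤ d) {δ : ℝ} (R : ℕ)
    (hδ : ∀ i < R, failBound (Fintype.card {v : V // lev v = i + 1}) d ≤ δ)
    {Q : Finset (V × V → Bool)} (hQ : ∀ i < R, InvariantOn (freshPairs lev (i + 1)) Q) :
    ((Q.filter fun a => ¬ ∃ g, EmbedsUpTo F lev R a g).card : ℝ) ≤ R * δ * Q.card := by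
  have hzero : ∀ a, ∃ g, EmbedsUpTo F lev 0 a g := fun a =>
    ⟨Equiv.refl V, fun _ => rfl, fun _ _ => rfl, fun u w h1 h2 => by omega⟩
  induction R with
  | zero =>
    have : (Q.filter fun a => ¬ ∃ g, EmbedsUpTo F lev 0 a g) = ∅ :=
      Finset.filter_eq_empty_iff.2 fun a _ => not_not.2 (hzero a)
    rw [this]
    simp
  | succ R ih =>
    have h1 := ih (fun i hi => hδ i (by omega)) (fun i hi => hQ i (by omega))
    have h2 := card_fail_step_le hl hdeg (hQ R (by omega))
    have h3 : (Q.filter fun a => ¬ ∃ g, EmbedsUpTo F lev (R + 1) a g) ⊆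
        (Q.filter fun a => ¬ ∃ g, EmbedsUpTo F lev R a g) ∪
        (Q.filter fun a => (∃ g, EmbedsUpTo F lev R a g) ∧
          ¬ ∃ g, EmbedsUpTo F lev (R + 1) a g) := by
      intro a
      simp only [Finset.mem_union, Finset.mem_filter]
      tauto
    have h4 : ((Q.filter fun a => ¬ ∃ g, EmbedsUpTo F lev (R + 1) a g).card : ℝ) ≤
        ((Q.filter fun a => ¬ ∃ g, EmbedsUpTo F lev R a g).card : ℝ) +
        (Q.filter fun a => (∃ g, EmbedsUpTo F lev R a g) ∧
          ¬ ∃ g, EmbedsUpTo F lev (R + 1) a g).card := by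
      exact_mod_cast (Finset.card_le_card h3).trans (Finset.card_union_le _ _)
    have h5 := h2.trans (mul_le_mul_of_nonneg_right (hδ R (by omega)) (Nat.cast_nonneg Q.card))
    push_cast
    linarith

end Levels

/-! ### Levels from colourings of the conflict graph -/

section Conflict

variable {V : Type*} [Fintype V] {F : Digraph V} {S : Set V} {d : ℕ}

theorem Connected.symm {V : Type*} {F : Digraph V} {u v : V} (h : Connected F u v) :
    Connected F v u :=
  ⟨h.1.symm, h.2.symm⟩

/-- Distinct nodes are in conflict when they are connected or have a common neighbour. -/
def conflictGraph {V : Type*} (F : Digraph V) : SimpleGraph V where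
  Adj u v := u ≠ v ∧ (Connected F u v ∨ ∃ w, Connected F u w ∧ Connected F v w)
  symm := ⟨fun _ _ h => ⟨h.1.symm, h.2.imp Connected.symm fun ⟨w, h1, h2⟩ => ⟨w, h2, h1⟩⟩⟩
  loopless := ⟨fun _ h => h.1 rfl⟩

open Classical in
theorem card_connected_le (hdeg : ∀ u, nodeDegree F u ≤ d) (u : V) :
    (Finset.univ.filter fun w => Connected F u w).card ≤ d := by
  refine le_trans ?_ (hdeg u)
  rw [nodeDegree, ← Set.ncard_coe_finset]
  exact Set.ncard_le_ncard (fun w hw => by simpa using hw) (Set.toFinite _)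

open Classical in
theorem card_conflictGraph_adj_le (hdeg : ∀ u, nodeDegree F u ≤ d) (u : V) :
    (Finset.univ.filter fun w => (conflictGraph F).Adj u w).card ≤ d ^ 2 + d := by
  have hsub : (Finset.univ.filter fun w => (conflictGraph F).Adj u w) ⊆
      ((Finset.univ.filter fun w => Connected F u w).biUnion fun w =>
        Finset.univ.filter fun v => Connected F w v) ∪
      Finset.univ.filter fun w => Connected F u w := by
    intro v hv
    simp only [Finset.mem_union, Finset.mem_biUnion, Finset.mem_filter, Finset.mem_univ,
      true_and] at hv ⊢
    rcases hv.2 with h | ⟨w, h1, h2⟩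
    · exact Or.inr h
    · exact Or.inl ⟨w, h1, h2.symm⟩
  refine (Finset.card_le_card hsub).trans ((Finset.card_union_le _ _).trans
    (Nat.add_le_add ?_ (card_connected_le hdeg u)))
  refine (Finset.card_biUnion_le_card_mul _ _ d fun w _ => card_connected_le hdeg w).trans ?_
  rw [sq]
  exact Nat.mul_le_mul_right _ (card_connected_le hdeg u)

theorem exists_balanced_coloring_on (hdeg : ∀ u, nodeDegree F u ≤ d) (A : Set V) :
    ∃ c : V → ℕ, (∀ v, c v < d ^ 2 + d + 1) ∧
      (∀ u ∈ A, ∀ v ∈ A, c u = c v → ¬ (conflictGraph F).Adj u v) ∧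
      ∀ i < d ^ 2 + d + 1, 100 * A.ncard ≤
        (133 * (d ^ 2 + d) + 301) * ({v | v ∈ A ∧ c v = i}.ncard + 100) := by
  classical
  obtain ⟨c, hc, hbal⟩ := exists_balanced_coloring (U := A) (D := d ^ 2 + d)
    (G := (conflictGraph F).comap Subtype.val) (by
      intro x
      refine le_trans ?_ (card_conflictGraph_adj_le hdeg (x : V))
      refine Finset.card_le_card_of_injOn Subtype.val (fun w hw => ?_)
        Subtype.val_injective.injOn
      simpa using hw)
  refine ⟨fun v => if hv : v ∈ A then c ⟨v, hv⟩ else 0, ?_, ?_, ?_⟩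
  · intro v
    by_cases hv : v ∈ A
    · simp only [hv, dif_pos]; exact (c ⟨v, hv⟩).2
    · simp [hv]
  · intro u hu v hv huv hadj
    simp only [hu, hv, dif_pos] at huv
    exact hc ⟨u, hu⟩ ⟨v, hv⟩ hadj (Fin.ext huv)
  · intro i hi
    have h1 := hbal ⟨i, hi⟩
    have h2 : (colorClass c ⟨i, hi⟩).card =
        {v | v ∈ A ∧ (if hv : v ∈ A then (c ⟨v, hv⟩ : ℕ) else 0) = i}.ncard := by
      rw [← Set.ncard_coe_finset, ← Set.ncard_image_of_injective _ Subtype.val_injective]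
      congr 1
      ext v
      simp only [Set.mem_image, Finset.mem_coe, mem_colorClass, Subtype.exists, Set.mem_ofPred_eq]
      constructor
      · rintro ⟨w, hw, hcw, rfl⟩
        exact ⟨hw, by rw [dif_pos hw, hcw]⟩
      · rintro ⟨hv, hcv⟩
        rw [dif_pos hv] at hcv
        exact ⟨v, hv, Fin.ext hcv, rfl⟩
    rw [h2, ← Nat.card_eq_fintype_card, Nat.card_coe_set_eq] at h1
    exact h1

theorem exists_isLevelling (F : Digraph V) (S : Set V) (hdeg : ∀ u, nodeDegree F u ≤ d) :
    ∃ lev : V → ℕ, IsLevelling F S lev ∧ (∀ v, lev v ≤ 2 * (d ^ 2 + d + 1)) ∧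
      ∀ i, Fintype.card {v : V // lev v = i + 1} ≠ 0 →
        ∃ A : Set V, (A = looped F ∨ A = unlooped F) ∧ A \ S ≠ ∅ ∧
          100 * (A \ S).ncard ≤ (133 * (d ^ 2 + d) + 301) *
            (Fintype.card {v : V // lev v = i + 1} + 100) := by
  classical
  obtain ⟨c₁, hlt₁, hc₁, hb₁⟩ := exists_balanced_coloring_on hdeg (looped F \ S)
  obtain ⟨c₂, hlt₂, hc₂, hb₂⟩ := exists_balanced_coloring_on hdeg (unlooped F \ S)
  set D := d ^ 2 + d with hD
  -- Looped nodes occupy levels `1` to `D + 1` and un-looped nodes levels `D + 2` to `2D + 2`, so no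
  -- level mixes them.
  let lev : V → ℕ := fun v => if v ∈ S then 0 else if F.Adj v v then c₁ v + 1 else c₂ v + D + 2
  have hlev0 : ∀ v, v ∈ S → lev v = 0 := fun v hv => if_pos hv
  have hlev1 : ∀ v, v ∉ S → F.Adj v v → lev v = c₁ v + 1 := fun v hv hl => by
    simp [lev, hv, hl]
  have hlev2 : ∀ v, v ∉ S → ¬ F.Adj v v → lev v = c₂ v + D + 2 := fun v hv hl => by
    simp [lev, hv, hl]
  have hzero : ∀ v, lev v = 0 ↔ v ∈ S := by
    intro v
    refine ⟨fun h => ?_, hlev0 v⟩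
    by_contra hv
    by_cases hl : F.Adj v v
    · rw [hlev1 v hv hl] at h; omega
    · rw [hlev2 v hv hl] at h; omega
  have hloop : ∀ u v, lev u = lev v → lev u ≠ 0 → (F.Adj u u ↔ F.Adj v v) := by
    intro u v huv hu
    have hv : v ∉ S := by rw [← hzero, ← huv]; exact hu
    rw [Ne, hzero] at hu
    have h1 := hlt₁ u
    have h2 := hlt₁ v
    by_cases hlu : F.Adj u u <;> by_cases hlv : F.Adj v v
    · simp [hlu, hlv]
    · rw [hlev1 u hu hlu, hlev2 v hv hlv] at huv; omega
    · rw [hlev2 u hu hlu, hlev1 v hv hlv] at huv; omega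
    · simp [hlu, hlv]
  have hconf : ∀ u v, lev u = lev v → lev u ≠ 0 → ¬ (conflictGraph F).Adj u v := by
    intro u v huv hu
    have hll := hloop u v huv hu
    have hv : v ∉ S := by rw [← hzero, ← huv]; exact hu
    rw [Ne, hzero] at hu
    by_cases hlu : F.Adj u u
    · have hlv := hll.1 hlu
      rw [hlev1 u hu hlu, hlev1 v hv hlv] at huv
      exact hc₁ u ⟨hlu, hu⟩ v ⟨hlv, hv⟩ (by omega)
    · have hlv : ¬ F.Adj v v := fun h => hlu (hll.2 h)
      rw [hlev2 u hu hlu, hlev2 v hv hlv] at huv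
      exact hc₂ u ⟨hlu, hu⟩ v ⟨hlv, hv⟩ (by omega)
  refine ⟨lev, ⟨hzero, hloop, ?_, ?_⟩, ?_, ?_⟩
  · exact fun u v huv hu hc => hconf u v huv hu ⟨hc.1, Or.inl hc⟩
  · intro u v w huv hu h1 h2
    by_contra hne
    exact hconf u v huv hu ⟨hne, Or.inr ⟨w, h1, h2⟩⟩
  · intro v
    have h1 := hlt₁ v
    have h2 := hlt₂ v
    by_cases hv : v ∈ S
    · rw [hlev0 v hv]; omega
    · by_cases hl : F.Adj v v
      · rw [hlev1 v hv hl]; omega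
      · rw [hlev2 v hv hl]; omega
  · intro i hi
    obtain ⟨v, hv⟩ := Fintype.card_pos_iff.1 (Nat.pos_of_ne_zero hi)
    have hvS : v ∉ S := by rw [← hzero]; omega
    rw [← Nat.card_eq_fintype_card, ← Set.coe_ofPred, Nat.card_coe_set_eq]
    by_cases hl : F.Adj v v
    · refine ⟨looped F, Or.inl rfl, Set.Nonempty.ne_empty ⟨v, hl, hvS⟩, ?_⟩
      have hiv : i = c₁ v := by rw [hlev1 v hvS hl] at hv; omega
      have he : {w | lev w = i + 1} = {w | w ∈ looped F \ S ∧ c₁ w = i} := by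
        ext w
        simp only [Set.mem_ofPred_eq]
        constructor
        · intro hw
          have hwS : w ∉ S := by rw [← hzero]; omega
          have hlw := (hloop v w (hv.trans hw.symm) (by omega)).1 hl
          exact ⟨⟨hlw, hwS⟩, by rw [hlev1 w hwS hlw] at hw; omega⟩
        · rintro ⟨⟨hlw, hwS⟩, hw⟩
          rw [hlev1 w hwS hlw, hw]
      rw [he]
      exact hb₁ i (hiv ▸ hlt₁ v)
    · refine ⟨unlooped F, Or.inr rfl, Set.Nonempty.ne_empty ⟨v, hl, hvS⟩, ?_⟩
      have hiv : i = c₂ v + D + 1 := by rw [hlev2 v hvS hl] at hv; omega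
      have he : {w | lev w = i + 1} = {w | w ∈ unlooped F \ S ∧ c₂ w = c₂ v} := by
        ext w
        simp only [Set.mem_ofPred_eq]
        constructor
        · intro hw
          have hwS : w ∉ S := by rw [← hzero]; omega
          have hlw : ¬ F.Adj w w := fun h =>
            hl ((hloop v w (hv.trans hw.symm) (by omega)).2 h)
          exact ⟨⟨hlw, hwS⟩, by rw [hlev2 w hwS hlw] at hw; omega⟩
        · rintro ⟨⟨hlw, hwS⟩, hw⟩
          rw [hlev2 w hwS hlw, hw, hiv]
      rw [he]
      exact hb₂ _ (hlt₂ v)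

/-- The table `a` has the loops of `F` and agrees with `F` on `S`. -/
def AgreesWith {V : Type*} (F : Digraph V) (S : Set V) (a : V × V → Bool) : Prop :=
  (∀ v, a (v, v) = true ↔ F.Adj v v) ∧ SameInducedOn S F (ofTable a)

/-- There is a di-embedding of `F` into the digraph of the table `a` that fixes `S`. -/
def EmbedsFixing {V : Type*} (F : Digraph V) (S : Set V) (a : V × V → Bool) : Prop :=
  ∃ g : V → V, IsDiEmbedding F (ofTable a) g ∧ ∀ u ∈ S, g u = u

/-- Connected nodes lie in different levels or both in `S`, where `g` is the identity. Loops are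
kept because `g` permutes levels that are uniform in loops. -/
theorem EmbedsUpTo.embedsFixing {V : Type*} {F : Digraph V} {S : Set V} {lev : V → ℕ}
    (hl : IsLevelling F S lev) {R : ℕ}
    (hR : ∀ v, lev v ≤ R) {a : V × V → Bool} (ha : AgreesWith F S a) {g : Equiv.Perm V}
    (hg : EmbedsUpTo F lev R a g) : EmbedsFixing F S a := by
  have hdiag : ∀ x, F.Adj x x ↔ a (g x, g x) = true := by
    intro x
    rw [ha.1]
    by_cases hx : lev x = 0
    · rw [hg.fix x hx]
    · exact hl.loop x (g x) (hg.lev_eq x).symm hx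
  have hoff : ∀ x y, Connected F x y → (F.Adj x y ↔ a (g x, g y) = true) := by
    intro x y hxy
    rcases lt_trichotomy (lev x) (lev y) with h | h | h
    · exact (hg.edge y x h (hR y) hxy.symm).2.symm
    · have hx : lev x = 0 := by
        by_contra hx
        exact hl.indep x y h hx hxy
      rw [hg.fix x hx, hg.fix y (h ▸ hx)]
      exact ha.2 x ((hl.zero_iff x).1 hx) y ((hl.zero_iff y).1 (h ▸ hx))
    · exact (hg.edge x y h (hR x) hxy).1.symm
  refine ⟨g, ⟨g.injective, ?_⟩, fun u hu => hg.fix u ((hl.zero_iff u).2 hu)⟩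
  intro u v huv x hx y hy
  change F.Adj x y ↔ a (g x, g y) = true
  rcases hx with rfl | hx <;> rcases hy with rfl | hy
  · exact hdiag _
  · obtain rfl : y = v := hy
    exact hoff _ _ huv
  · obtain rfl : x = v := hx
    exact hoff _ _ huv.symm
  · obtain rfl : x = v := hx
    obtain rfl : y = x := hy
    exact hdiag _

open Classical in
theorem card_agreesWith_fail_le (hdeg : ∀ u, nodeDegree F u ≤ d) {lev : V → ℕ}
    (hl : IsLevelling F S lev) {R : ℕ} (hR : ∀ v, lev v ≤ R) {δ : ℝ}
    (hδ : ∀ i < R, failBound (Fintype.card {v : V // lev v = i + 1}) d ≤ δ) :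
    (((Finset.univ.filter fun a => AgreesWith F S a).filter fun a =>
        ¬ EmbedsFixing F S a).card : ℝ) ≤
      R * δ * (Finset.univ.filter fun a => AgreesWith F S a).card := by
  refine le_trans ?_ (card_fail_le (Q := Finset.univ.filter fun a => AgreesWith F S a)
    hl hdeg R hδ ?_)
  · refine Nat.cast_le.2 (Finset.card_le_card fun a ha => ?_)
    obtain ⟨haQ, hno⟩ := Finset.mem_filter.1 ha
    refine Finset.mem_filter.2 ⟨haQ, ?_⟩
    rintro ⟨g, hg⟩
    exact hno (hg.embedsFixing hl hR (Finset.mem_filter.1 haQ).2)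
  · intro i _ a b hab ha
    have hag := (Finset.mem_filter.1 ha).2
    refine Finset.mem_filter.2 ⟨Finset.mem_univ _, fun v => ?_, fun u hu v hv => ?_⟩
    · rw [← hab (v, v) (by rw [mem_freshPairs]; simp only; omega)]
      exact hag.1 v
    · have h1 := (hl.zero_iff u).2 hu
      have h2 := (hl.zero_iff v).2 hv
      refine (hag.2 u hu v hv).trans ?_
      change a (u, v) = true ↔ b (u, v) = true
      rw [hab (u, v) (by rw [mem_freshPairs]; simp only; omega)]

end Conflict

/-! ### Reduction to tables with the loops of `F` -/

section Loops

variable {V : Type*} [Fintype V] {F : Digraph V} {S : Set V}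

theorem exists_perm_comp_eq {ι : Type*} {f h : V → ι}
    (hfh : ∀ y, {x | f x = y}.ncard = {x | h x = y}.ncard) :
    ∃ π : Equiv.Perm V, ∀ v, h (π v) = f v := by
  have e : ∀ y, Nonempty ({x // f x = y} ≃ {x // h x = y}) := by
    intro y
    have := hfh y
    rw [← Nat.card_coe_set_eq, ← Nat.card_coe_set_eq] at this
    exact Finite.card_eq.1 this
  refine ⟨((Equiv.sigmaFiberEquiv f).symm.trans
    (Equiv.sigmaCongrRight fun y => (e y).some)).trans (Equiv.sigmaFiberEquiv h), fun v => ?_⟩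
  exact ((e (f v)).some ⟨v, rfl⟩).2

theorem ncard_diff_eq {A B : Set V} (hAB : A.ncard = B.ncard) (hS : A ∩ S = B ∩ S) :
    (A \ S).ncard = (B \ S).ncard := by
  have h1 := Set.ncard_inter_add_ncard_sdiff_eq_ncard A S (Set.toFinite _)
  have h2 := Set.ncard_inter_add_ncard_sdiff_eq_ncard B S (Set.toFinite _)
  rw [hS] at h1
  omega

/-- A permutation fixing `S` and carrying the loops of `F` to those of a compatible digraph. -/
theorem exists_perm_loops {G : Digraph V} (hS : SameInducedOn S F G) (hc : Compatible F G) :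
    ∃ π : Equiv.Perm V, (∀ v ∈ S, π v = v) ∧ ∀ v, G.Adj (π v) (π v) ↔ F.Adj v v := by
  classical
  -- Nodes of `S` are labelled individually, the others only by their loop. A permutation matching
  -- these labels therefore fixes `S`.
  let f : Digraph V → V → V ⊕ Prop := fun G v => if v ∈ S then Sum.inl v else Sum.inr (G.Adj v v)
  have hf1 : ∀ G v, v ∈ S → f G v = Sum.inl v := fun G v hv => if_pos hv
  have hf2 : ∀ G v, v ∉ S → f G v = Sum.inr (G.Adj v v) := fun G v hv => if_neg hv
  have hl : ∀ v ∈ S, (F.Adj v v ↔ G.Adj v v) := fun v hv => hS v hv v hv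
  have hfib : ∀ G p, {v | f G v = Sum.inr p} =
      (if p then looped G else unlooped G) \ S := by
    intro G p
    ext v
    by_cases hv : v ∈ S
    · simp [hf1 G v hv, hv]
    · by_cases hp : p <;> simp [hf2 G v hv, hv, hp, looped, unlooped]
  obtain ⟨π, hπ⟩ := exists_perm_comp_eq (f := f F) (h := f G) (by
    rintro (v | p)
    · congr 1
      ext w
      by_cases hw : w ∈ S
      · simp [hf1 _ w hw]
      · simp [hf2 _ w hw]
    · rw [hfib, hfib]
      by_cases hp : p
      · simp only [hp, if_true]
        exact ncard_diff_eq hc.1 (Set.ext fun v => and_congr_left (hl v))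
      · simp only [hp, if_false]
        exact ncard_diff_eq hc.2 (Set.ext fun v => and_congr_left fun hv => not_congr (hl v hv)))
  have hfix : ∀ v ∈ S, π v = v := by
    intro v hv
    have h1 := hπ v
    rw [hf1 F v hv] at h1
    by_cases hπv : π v ∈ S
    · rw [hf1 G _ hπv] at h1
      exact Sum.inl.inj h1
    · rw [hf2 G _ hπv] at h1
      exact absurd h1 Sum.inr_ne_inl
  refine ⟨π, hfix, fun v => ?_⟩
  by_cases hv : v ∈ S
  · rw [hfix v hv]
    exact (hl v hv).symm
  · have h1 := hπ v
    rw [hf2 F v hv] at h1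
    by_cases hπv : π v ∈ S
    · rw [hf1 G _ hπv] at h1
      exact absurd h1 Sum.inl_ne_inr
    · rw [hf2 G _ hπv] at h1
      exact iff_of_eq (Sum.inr.inj h1)

/-- The conditioning event. -/
def Admissible {V : Type*} (F : Digraph V) (S : Set V) (a : V × V → Bool) : Prop :=
  SameInducedOn S F (ofTable a) ∧ Compatible F (ofTable a)

/-- Relabelling a table by a permutation of the nodes. -/
def permuted {V : Type*} (π : Equiv.Perm V) (a : V × V → Bool) : V × V → Bool :=
  fun e => a (π e.1, π e.2)

theorem permuted_injective {V : Type*} (π : Equiv.Perm V) : Function.Injective (permuted π) := by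
  intro a b hab
  funext ⟨x, y⟩
  have := congrFun hab (π.symm x, π.symm y)
  simpa [permuted] using this

theorem EmbedsFixing.of_permuted {V : Type*} {F : Digraph V} {S : Set V} {π : Equiv.Perm V}
    (hπ : ∀ v ∈ S, π v = v) {a : V × V → Bool} (h : EmbedsFixing F S (permuted π a)) :
    EmbedsFixing F S a := by
  obtain ⟨g, hg, hS⟩ := h
  refine ⟨fun v => π (g v), ⟨π.injective.comp hg.injective, hg.iso⟩, fun u hu => ?_⟩
  change π (g u) = u
  rw [hS u hu, hπ u hu]

open Classical in
/-- It suffices to bound the failures among the tables with the loops of `F`. -/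
theorem card_admissible_fail_le {η : ℝ}
    (hη : (((Finset.univ.filter fun a => AgreesWith F S a).filter fun a =>
        ¬ EmbedsFixing F S a).card : ℝ) ≤
      η * (Finset.univ.filter fun a => AgreesWith F S a).card) (hη0 : 0 ≤ η) :
    (((Finset.univ.filter fun a => Admissible F S a).filter fun a =>
        ¬ EmbedsFixing F S a).card : ℝ) ≤
      η * (Finset.univ.filter fun a => Admissible F S a).card := by
  set A := Finset.univ.filter fun a => Admissible F S a with hA
  set Q := Finset.univ.filter fun a => AgreesWith F S a with hQ
  let diag : (V × V → Bool) → Finset V := fun a => Finset.univ.filter fun v => a (v, v) = true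
  have hdiag : ∀ a v, v ∈ diag a ↔ a (v, v) = true := by intro a v; simp [diag]
  rw [Finset.card_eq_sum_card_fiberwise (f := diag) (s := A) (t := Finset.univ)
      (fun _ _ => Finset.mem_univ _),
    Finset.card_eq_sum_card_fiberwise (f := diag) (s := A.filter fun a => ¬ EmbedsFixing F S a)
      (t := Finset.univ) (fun _ _ => Finset.mem_univ _)]
  push_cast
  rw [Finset.mul_sum]
  -- For each loop set `L`, relabelling sends the failures over `L` injectively to failures with the
  -- loops of `F`. The inverse relabelling sends all tables agreeing with `F` into the fibre over
  -- `L`, so the failure ratio carries over.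
  refine Finset.sum_le_sum fun L _ => ?_
  rcases Finset.eq_empty_or_nonempty
    ((A.filter fun a => ¬ EmbedsFixing F S a).filter fun a => diag a = L) with he | ⟨a₀, ha₀⟩
  · rw [he, Finset.card_empty, Nat.cast_zero]
    positivity
  obtain ⟨ha₁, rfl⟩ := Finset.mem_filter.1 ha₀
  have hadm : Admissible F S a₀ := (Finset.mem_filter.1 (Finset.mem_filter.1 ha₁).1).2
  obtain ⟨π, hfix, hloop⟩ := exists_perm_loops hadm.1 hadm.2
  have hfix' : ∀ v ∈ S, π.symm v = v := fun v hv => by rw [Equiv.symm_apply_eq, hfix v hv]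
  have hle1 : ((A.filter fun a => ¬ EmbedsFixing F S a).filter fun a => diag a = diag a₀).card ≤
      (Q.filter fun a => ¬ EmbedsFixing F S a).card := by
    refine Finset.card_le_card_of_injOn (permuted π) ?_ (permuted_injective π).injOn
    intro a ha
    obtain ⟨haA, had⟩ := Finset.mem_filter.1 (Finset.mem_coe.1 ha)
    obtain ⟨haA, hno⟩ := Finset.mem_filter.1 haA
    have haA' : Admissible F S a := (Finset.mem_filter.1 haA).2
    refine Finset.mem_coe.2 (Finset.mem_filter.2 ⟨Finset.mem_filter.2 ⟨Finset.mem_univ _, ?_, ?_⟩,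
      fun h => hno (h.of_permuted hfix)⟩)
    · intro v
      change a (π v, π v) = true ↔ _
      rw [← hdiag, had, hdiag]
      exact hloop v
    · intro u hu v hv
      change F.Adj u v ↔ a (π u, π v) = true
      rw [hfix u hu, hfix v hv]
      exact haA'.1 u hu v hv
  have hle2 : Q.card ≤ (A.filter fun a => diag a = diag a₀).card := by
    refine Finset.card_le_card_of_injOn (permuted π.symm) ?_ (permuted_injective π.symm).injOn
    intro b hb
    have hb' : AgreesWith F S b := (Finset.mem_filter.1 (Finset.mem_coe.1 hb)).2
    have hd : ∀ v, permuted π.symm b (v, v) = true ↔ a₀ (v, v) = true := by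
      intro v
      change b (π.symm v, π.symm v) = true ↔ _
      rw [hb'.1, ← hloop, Equiv.apply_symm_apply]
      rfl
    have hl1 : looped (ofTable (permuted π.symm b)) = looped (ofTable a₀) := by
      ext v; exact hd v
    have hl2 : unlooped (ofTable (permuted π.symm b)) = unlooped (ofTable a₀) := by
      ext v; exact not_congr (hd v)
    refine Finset.mem_coe.2 (Finset.mem_filter.2
      ⟨Finset.mem_filter.2 ⟨Finset.mem_univ _, ?_, ?_, ?_⟩, ?_⟩)
    · intro u hu v hv
      change F.Adj u v ↔ b (π.symm u, π.symm v) = true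
      rw [hfix' u hu, hfix' v hv]
      exact hb'.2 u hu v hv
    · rw [hl1]; exact hadm.2.1
    · rw [hl2]; exact hadm.2.2
    · ext v
      rw [hdiag, hdiag, hd]
  calc _ ≤ ((Q.filter fun a => ¬ EmbedsFixing F S a).card : ℝ) := Nat.cast_le.2 hle1
    _ ≤ η * Q.card := hη
    _ ≤ _ := mul_le_mul_of_nonneg_left (Nat.cast_le.2 hle2) hη0

end Loops

/-! ### From counting to conditional probability -/

section Law

variable {V : Type*} [Fintype V]

theorem edgeLaw_singleton (a : V × V → Bool) :
    edgeLaw V {a} = (2⁻¹ : ENNReal) ^ Fintype.card (V × V) := by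
  rw [edgeLaw, Measure.pi_singleton]
  simp

instance isProbabilityMeasure_edgeLaw : IsProbabilityMeasure (edgeLaw V) := by
  unfold edgeLaw; infer_instance

open Classical in
theorem edgeLaw_real (s : Finset (V × V → Bool)) :
    (edgeLaw V).real s = ((2 : ℝ)⁻¹) ^ Fintype.card (V × V) * s.card := by
  rw [← sum_measureReal_singleton]
  have : ∀ a, (edgeLaw V).real {a} = ((2 : ℝ)⁻¹) ^ Fintype.card (V × V) := by
    intro a
    rw [measureReal_def, edgeLaw_singleton]
    simp
  simp [this, mul_comm]

open Classical in
theorem one_sub_le_condLaw_real {F : Digraph V} {S : Set V} {η : ℝ}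
    (hη : (((Finset.univ.filter fun a => Admissible F S a).filter fun a =>
        ¬ EmbedsFixing F S a).card : ℝ) ≤
      η * (Finset.univ.filter fun a => Admissible F S a).card) :
    1 - η ≤ (condLaw F S).real {a | EmbedsFixing F S a} := by
  set A := Finset.univ.filter fun a => Admissible F S a with hA
  have hAset : {a | SameInducedOn S F (ofTable a) ∧ Compatible F (ofTable a)} = (A : Set _) := by
    ext a; simp only [hA, Finset.coe_filter, Finset.mem_univ, true_and]; rfl
  have hcap : (A : Set (V × V → Bool)) ∩ {a | EmbedsFixing F S a} =
      (A.filter fun a => EmbedsFixing F S a : Finset _) := by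
    ext a; simp
  -- The table of `F` itself is admissible, so the conditioning event has positive probability.
  have hAne : A.Nonempty := by
    refine ⟨fun e => decide (F.Adj e.1 e.2), Finset.mem_filter.2 ⟨Finset.mem_univ _, ?_⟩⟩
    have : ofTable (fun e : V × V => decide (F.Adj e.1 e.2)) = F := by
      ext u v; simp [ofTable]
    rw [Admissible, this]
    exact ⟨fun _ _ _ _ => Iff.rfl, rfl, rfl⟩
  have hApos : (0 : ℝ) < A.card := by exact_mod_cast hAne.card_pos
  rw [condLaw, hAset, measureReal_def, cond_apply (A.finite_toSet.measurableSet),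
    ENNReal.toReal_mul, ENNReal.toReal_inv, ← measureReal_def, ← measureReal_def, hcap,
    edgeLaw_real, edgeLaw_real]
  have h1 : ((A.filter fun a => EmbedsFixing F S a).card : ℝ) +
      (A.filter fun a => ¬ EmbedsFixing F S a).card = A.card := by
    exact_mod_cast Finset.card_filter_add_card_filter_not (s := A) _
  have h2 : (0 : ℝ) < (2⁻¹ : ℝ) ^ Fintype.card (V × V) := by positivity
  rw [mul_inv, mul_mul_mul_comm, inv_mul_cancel₀ h2.ne', one_mul, ← div_eq_inv_mul,
    le_div_iff₀ hApos]
  linarith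

end Law

/-! ### Numerical estimates -/

section Asymptotics

theorem exists_forall_pow_mul_exp_le {ε : ℝ} (hε : 0 < ε) :
    ∃ L : ℝ, 1 ≤ L ∧ ∀ t, L ≤ t →
      1200 * (t ^ 3 * Real.exp (-0.02 * t)) + 443904 * (t ^ 4 * Real.exp (-(1 / 3) * t)) ≤ ε := by
  have h1 := tendsto_rpow_mul_exp_neg_mul_atTop_nhds_zero 3 0.02 (by norm_num)
  have h2 := tendsto_rpow_mul_exp_neg_mul_atTop_nhds_zero 4 (1 / 3) (by norm_num)
  have h3 := (h1.const_mul 1200).add (h2.const_mul 443904)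
  rw [mul_zero, mul_zero, add_zero] at h3
  obtain ⟨L, hL⟩ := eventually_atTop.1 (h3.eventually_le_const hε)
  refine ⟨max L 1, le_max_right _ _, fun t ht => ?_⟩
  have := hL t ((le_max_left _ _).trans ht)
  exact_mod_cast this

/-- The total failure bound is small once the levels are large. -/
theorem exists_forall_mul_failBound_le {ε : ℝ} (hε : 0 < ε) :
    ∃ L : ℝ, ∀ d k : ℕ, L * 4 ^ d ≤ k → 1.48 * (d : ℝ) * 4 ^ d ≤ k →
      ((2 * (d ^ 2 + d + 1) : ℕ) : ℝ) * failBound k d ≤ ε := by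
  obtain ⟨L, hL1, hL⟩ := exists_forall_pow_mul_exp_le hε
  refine ⟨L, fun d k hk1 hk2 => ?_⟩
  have h4 : (0 : ℝ) < 4 ^ d := by positivity
  obtain ⟨t, ht⟩ : ∃ t : ℝ, (k : ℝ) = t * 4 ^ d := ⟨k / 4 ^ d, by field_simp⟩
  have htL : L ≤ t := by rw [ht] at hk1; exact le_of_mul_le_mul_right hk1 h4
  have htd : 1.48 * d ≤ t := by rw [ht] at hk2; exact le_of_mul_le_mul_right hk2 h4
  have ht1 : 1 ≤ t := hL1.trans htL
  have hlam : (k : ℝ) * ((4 : ℝ) ^ d)⁻¹ = t := by rw [ht]; field_simp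
  -- Here `t = kp ≥ 1.48 d`, and `0.94 · 1.48 = 1.3912` exceeds `2 log 2 ≈ 1.3863`. The difference
  -- `0.96 - 0.94 = 0.02` is the remaining rate of decay.
  have hexp : (4 : ℝ) ^ d ≤ Real.exp (0.94 * t) := by
    have h2 : (4 : ℝ) ^ d = Real.exp (d * (2 * Real.log 2)) := by
      rw [mul_comm, Real.exp_mul, Real.rpow_natCast, two_mul, Real.exp_add,
        Real.exp_log (by norm_num)]
      norm_num
    rw [h2, Real.exp_le_exp]
    have := Real.log_two_lt_d9
    have hd : (0 : ℝ) ≤ d := by positivity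
    nlinarith
  have hR : ((2 * (d ^ 2 + d + 1) : ℕ) : ℝ) ≤ 6 * t ^ 2 := by
    push_cast
    have hd : (0 : ℝ) ≤ d := by positivity
    have hdt : (d : ℝ) ≤ t := by linarith
    nlinarith
  have hfb : failBound k d ≤
      4 * (50 * t * Real.exp (-0.02 * t) + (136 * t) ^ 2 * Real.exp (-(1 / 3) * t)) := by
    have e1 : (k : ℝ) * Real.exp (-(0.96 * t)) ≤ t * Real.exp (-0.02 * t) := by
      calc (k : ℝ) * Real.exp (-(0.96 * t)) = t * (4 ^ d * Real.exp (-(0.96 * t))) := by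
            rw [ht]; ring
        _ ≤ t * (Real.exp (0.94 * t) * Real.exp (-(0.96 * t))) := by gcongr
        _ = _ := by rw [← Real.exp_add]; ring_nf
    have e2 : -(t / 3) = -(1 / 3) * t := by ring
    rw [failBound, hlam, e2]
    nlinarith
  calc ((2 * (d ^ 2 + d + 1) : ℕ) : ℝ) * failBound k d ≤ 6 * t ^ 2 *
        (4 * (50 * t * Real.exp (-0.02 * t) + (136 * t) ^ 2 * Real.exp (-(1 / 3) * t))) :=
        mul_le_mul hR hfb (failBound_nonneg _ _) (by positivity)
    _ = 1200 * (t ^ 3 * Real.exp (-0.02 * t)) + 443904 * (t ^ 4 * Real.exp (-(1 / 3) * t)) := by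
        ring
    _ ≤ ε := hL t htL

/-- Balanced classes of a large enough set are large enough to be embedded. -/
theorem exists_forall_class_large (L : ℝ) :
    ∃ M : ℝ, ∀ d m k : ℕ, 2 * (d : ℝ) ^ 3 * 4 ^ d + M < m →
      100 * m ≤ (133 * (d ^ 2 + d) + 301) * (k + 100) →
      L * 4 ^ d ≤ (k : ℝ) ∧ 1.48 * d * 4 ^ d ≤ (k : ℝ) := by
  -- Degrees up to `b` are absorbed by the additive constant. Above `b`, the leading coefficient
  -- `133 · 1.48 = 196.84` is below `100 · 2`, and `5000` makes the lower-order terms negligible.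
  obtain ⟨b, hb⟩ := exists_nat_ge (max L 5000)
  have hbL : L ≤ b := (le_max_left _ _).trans hb
  have hb5 : (5000 : ℝ) ≤ b := (le_max_right _ _).trans hb
  refine ⟨(133 * ((b : ℝ) ^ 2 + b) + 301) * (1.48 * b * 4 ^ b + 100), fun d m k hm hk => ?_⟩
  suffices hs : max L (1.48 * d) * 4 ^ d ≤ k by
    have h4 : (0 : ℝ) ≤ 4 ^ d := by positivity
    exact ⟨(mul_le_mul_of_nonneg_right (le_max_left _ _) h4).trans hs,
      (mul_le_mul_of_nonneg_right (le_max_right _ _) h4).trans hs⟩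
  have hk' : (100 : ℝ) * m ≤ (133 * ((d : ℝ) ^ 2 + d) + 301) * (k + 100) := by exact_mod_cast hk
  have hd0 : (0 : ℝ) ≤ d := by positivity
  have h4 : (1 : ℝ) ≤ 4 ^ d := one_le_pow₀ (by norm_num)
  set C : ℝ := 133 * ((d : ℝ) ^ 2 + d) + 301 with hC
  have hCpos : 0 < C := by positivity
  have hM : (0 : ℝ) ≤ (133 * ((b : ℝ) ^ 2 + b) + 301) * (1.48 * b * 4 ^ b + 100) := by positivity
  suffices hs : C * (max L (1.48 * d) * 4 ^ d + 100) ≤ 100 * m by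
    have := le_of_mul_le_mul_left (hs.trans hk') hCpos
    linarith
  by_cases hdb : (d : ℝ) ≤ b
  · have hmax : max L (1.48 * d) ≤ 1.48 * b := max_le (by linarith) (by linarith)
    have hdb' : d ≤ b := by exact_mod_cast hdb
    have h4b : (4 : ℝ) ^ d ≤ 4 ^ b := pow_le_pow_right₀ (by norm_num) hdb'
    have h2 : 0 ≤ 2 * (d : ℝ) ^ 3 * 4 ^ d := by positivity
    calc C * (max L (1.48 * d) * 4 ^ d + 100) ≤
          (133 * ((b : ℝ) ^ 2 + b) + 301) * (1.48 * b * 4 ^ b + 100) := by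
          rw [hC]
          gcongr
      _ ≤ 100 * m := by linarith
  · push Not at hdb
    have hmax : max L (1.48 * d) = 1.48 * d := max_eq_right (by linarith)
    have hd5 : (5000 : ℝ) ≤ d := by linarith
    have hpoly : C * (1.48 * d + 100) ≤ 200 * (d : ℝ) ^ 3 := by
      have e1 : 5000 * (d : ℝ) ≤ d ^ 2 := by nlinarith
      have e2 : 5000 * (d : ℝ) ^ 2 ≤ d ^ 3 := by nlinarith [sq_nonneg (d : ℝ)]
      rw [hC]
      nlinarith
    rw [hmax]
    calc C * (1.48 * d * 4 ^ d + 100) ≤ C * (1.48 * d * 4 ^ d + 100 * 4 ^ d) := by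
          gcongr; linarith
      _ = C * (1.48 * d + 100) * 4 ^ d := by ring
      _ ≤ 200 * (d : ℝ) ^ 3 * 4 ^ d := by gcongr
      _ ≤ 100 * m := by linarith

end Asymptotics

/-! ### The embedding lemma -/

theorem nodeDegree_le_degree {V : Type*} [Fintype V] (F : Digraph V) (u : V) :
    nodeDegree F u ≤ degree F :=
  Finset.le_sup (f := nodeDegree F) (Finset.mem_univ u)

end DiEmbed

theorem lemma4 (ω : ℕ → ℝ) (hω : Filter.Tendsto ω Filter.atTop Filter.atTop)
    (ε : ℝ) (hε : 0 < ε) :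
    ∃ N : ℕ, ∀ (V : Type*) [Fintype V] (F : Digraph V) (S : Set V) (n d : ℕ),
      n = Fintype.card V → N ≤ n → d = DiEmbed.degree F →
      2 * (d : ℝ) ^ 3 * 4 ^ d + ω n < (Sᶜ.ncard : ℝ) →
      (DiEmbed.looped F \ S = ∅ ∨
        2 * (d : ℝ) ^ 3 * 4 ^ d + ω n < ((DiEmbed.looped F \ S).ncard : ℝ)) →
      (DiEmbed.unlooped F \ S = ∅ ∨
        2 * (d : ℝ) ^ 3 * 4 ^ d + ω n < ((DiEmbed.unlooped F \ S).ncard : ℝ)) →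
      1 - ε ≤ (DiEmbed.condLaw F S).real
        {a | ∃ g : V → V, DiEmbed.IsDiEmbedding F (DiEmbed.ofTable a) g ∧ ∀ u ∈ S, g u = u} := by
  obtain ⟨L, hL⟩ := DiEmbed.exists_forall_mul_failBound_le hε
  obtain ⟨M, hM⟩ := DiEmbed.exists_forall_class_large L
  -- `L` and `M` come from `ε` alone, so `N` depends only on `ω` and `ε`.
  obtain ⟨N, hN⟩ := eventually_atTop.1 (hω.eventually_ge_atTop M)
  refine ⟨N, ?_⟩
  intro V _ F S n d _ hn hd _ hloop hunloop
  have hdeg : ∀ u, DiEmbed.nodeDegree F u ≤ d := fun u => hd ▸ DiEmbed.nodeDegree_le_degree F u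
  obtain ⟨lev, hl, hR, hsize⟩ := DiEmbed.exists_isLevelling F S hdeg
  set R := 2 * (d ^ 2 + d + 1) with hRdef
  have hRpos : (0 : ℝ) < R := by exact_mod_cast (by omega : 0 < R)
  have hfail : ∀ i < R,
      DiEmbed.failBound (Fintype.card {v : V // lev v = i + 1}) d ≤ ε / R := by
    intro i _
    rw [le_div_iff₀' hRpos]
    -- Each of the `R` levels may fail with probability `ε / R`. An empty level has no size
    -- guarantee, but its bound is `0`.
    by_cases hk : Fintype.card {v : V // lev v = i + 1} = 0
    · rw [hk]
      simp [DiEmbed.failBound, hε.le]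
    · obtain ⟨A, hA, hne, hcard⟩ := hsize i hk
      have hbig : 2 * (d : ℝ) ^ 3 * 4 ^ d + ω n < ((A \ S).ncard : ℝ) := by
        rcases hA with rfl | rfl
        · exact hloop.resolve_left hne
        · exact hunloop.resolve_left hne
      have := hM d _ _ (lt_of_le_of_lt (by linarith [hN n hn]) hbig) hcard
      exact hL d _ this.1 this.2
  have h1 := DiEmbed.card_agreesWith_fail_le hdeg hl hR hfail
  rw [mul_div_cancel₀ _ hRpos.ne'] at h1
  exact DiEmbed.one_sub_le_condLaw_real (DiEmbed.card_admissible_fail_le h1 hε.le)
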